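/- **Setting.** Let $X_1=(X_1',V)$, $X_2=(X_2',V)$ be a discrete memoryless source with finite alphabets, where $X_1'$ and $X_2'$ are conditionally independent given $V$. Let $K\ge 2$. All entropies are in bits. For block length $F$ the two library files are $X_1^F,X_2^F$ (i.i.d. pairs). A *cache-aided coded multicast scheme* with capacity $M$ stores at each of $K$ receivers a function $Z_k$ of $(X_1^F,X_2^F)$ with at most $2^{MF}$ values; for each demand $\mathbf d\in\{1,2\}^K$ a binary codeword $Y_{\mathbf d}$ of variable length, a function of the library and the cache contents, is broadcast, and receiver $k$ estimates $X_{d_k}^F$ from $(\mathbf d,Y_{\mathbf d},Z_k)$. The error probability is the maximum over $\mathbf d$ of the probability that some receiver errs. The peak (average) rate is the maximum (uniform average) over $\mathbf d$ of $\mathbb E[\mathrm{length}(Y_{\mathbf d})]/F$. A pair $(R,M)$ is achievable if there are schemes of capacity $M$, $F\to\infty$, with error probability tending to $0$ and $\limsup$ of the rate at most $R$. Let $R^*(M)=\inf\{R:(R,M)\in\mathcal R\}$, where $\mathcal R$ is the closure of the set of achievable pairs for the peak rate, and let $\bar R^*(M)$ be the analogous quantity for the average rate. **Gray–Wyner region.**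 $\mathfrak R_{GW}$ is the closure of the set of $\boldsymbol\rho=(\rho_0,\rho_1,\rho_2)$ for which there are encodings of $(X_1^F,X_2^F)$ into descriptions $W_0,W_1,W_2$, where $W_i$ has at most $2^{F\rho_i}$ values, such that $X_1^F$ is recovered from $(W_0,W_1)$ and $X_2^F$ from $(W_0,W_2)$ with error probability tending to $0$. **The proposed GW-MR scheme.** For $\boldsymbol\rho\in\mathfrak R_{GW}$, regard $W_i$ as a string of $\lceil F\rho_i\rceil$ bits. Every receiver stores the first $\lfloor\mu_0F\rfloor$ bits of $W_0$, $0\le\mu_0\le\rho_0$; the other bits of $W_0$ are sent uncoded. Independently of this, the pair $(W_1,W_2)$ is cached and delivered by memory sharing (splitting both strings in the same proportion, repeatedly) among the following basic schemes. For strings of lengths $n_1,n_2$ let $s=\lfloor\min(n_1,n_2)/K\rfloor$, let $W_i^{(1)},\dots,W_i^{(K)}$ be the first $K$ packets of $s$ bits of $W_i$, and call the rest of $W_i$ its leftover; the leader of a file is the first receiver requesting it. (a) Nothing is cached; the requested strings are sent. (b) Peak criterion only: receiver $k$ stores $W_1^{(k)}\oplus W_2^{(k)}$. If both files are requested, the codeword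 consists of the packets $W_{3-d_k}^{(k)}$ for all $k$, of $W_i^{(u)}\oplus W_i^{(j)}$ for each file $i$, its leader $u$ and each other receiver $j$ requesting $i$, and of both leftovers; otherwise the requested string is sent. (b') Average criterion only: receiver $k$ stores $W_1^{(k)},W_2^{(k)}$. The codeword consists of $W_{d_k}^{(j)}\oplus W_{d_j}^{(k)}$ for each pair $\{k,j\}$ of receivers containing a leader, and of the leftovers of the requested strings. (c) Receiver $k$ stores everything except $W_1^{(k)},W_2^{(k)}$; the codeword is $\bigoplus_{k=1}^K W_{d_k}^{(k)}$. (d) Everything is stored; nothing is sent. In each case receiver $k$ recovers $W_0$ and $W_{d_k}$ without error. Let $R_{MR}(M,\boldsymbol\rho)$ be $\inf\{R:(R,M)\in\mathcal R_{\boldsymbol\rho}\}$, where $\mathcal R_{\boldsymbol\rho}$ is the closure of the set of pairs $(R,M)$ for which some choice of $\mu_0$ and of the memory sharing among (a), (b), (c), (d) uses, for all large $F$, at most $MF$ cached bits per receiver, and has $\limsup_F$ of its peak rate at most $R$; let $\bar R_{MR}(M,\boldsymbol\rho)$ be the same for the average rate and (a), (b'), (c), (d). Put $R^{GW}(M)=\inf_{\boldsymbol\rho\in\mathfrak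 R_{GW}}R_{MR}(M,\boldsymbol\rho)$ and $\bar R^{GW}(M)=\inf_{\boldsymbol\rho\in\mathfrak R_{GW}}\bar R_{MR}(M,\boldsymbol\rho)$. **Claim.** Let $\Gamma=\min\{H(X_1|X_2),H(X_2|X_1)\}$. 1. $R^{GW}(M)=R^*(M)$ for all $M\in\big[0,\tfrac1K\Gamma\big]\cup\big[H(X_1,X_2)-\tfrac2K\Gamma,\;H(X_1,X_2)\big]$. 2. $\bar R^{GW}(M)=\bar R^*(M)$ for all $M\in\big[H(X_1,X_2)-\tfrac2K\Gamma,\;H(X_1,X_2)\big]$. 3. If $K=2$, then $R^{GW}(M)=R^*(M)$ and $\bar R^{GW}(M)=\bar R^*(M)$ for all $M\in[0,H(X_1,X_2)]$. -/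

import Mathlib

open Filter Topology

namespace GWCaching

/-! ### Finite random variables and entropy (in bits)

A probability mass function on a finite type `S` is a function `p : S → ℝ` with
`p ∈ stdSimplex ℝ S`; a random variable is a function on `S`. -/

section Entropy

variable {S T U : Type*} [Fintype S] [DecidableEq T] [DecidableEq U]

/-- The law of the random variable `f` under the pmf `p`. -/
def law (p : S → ℝ) (f : S → T) (t : T) : ℝ :=
  ∑ s with f s = t, p s

/-- Shannon entropy `H(f)`, in bits. -/
noncomputable def entropy [Fintype T] (p : S → ℝ) (f : S → T) : ℝ :=
  ∑ t, Real.negMulLog (law p f t) / Real.log 2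

/-- Conditional entropy
`H(f | g) = - ∑ P(f = t, g = u) log₂ (P(f = t, g = u) / P(g = u))`, in bits. -/
noncomputable def condEntropy [Fintype T] [Fintype U] (p : S → ℝ) (f : S → T) (g : S → U) : ℝ :=
  -∑ t, ∑ u, law p (fun s => (f s, g s)) (t, u) *
    Real.logb 2 (law p (fun s => (f s, g s)) (t, u) / law p g u)

/-- `f` and `g` are conditionally independent given `h`:
`P(f, g, h) P(h) = P(f, h) P(g, h)`. -/
def CondIndep {V : Type*} [DecidableEq V] (p : S → ℝ) (f : S → T) (g : S → U) (h : S → V) : Prop :=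
  ∀ t u v, law p (fun s => (f s, g s, h s)) (t, u, v) * law p h v =
    law p (fun s => (f s, h s)) (t, v) * law p (fun s => (g s, h s)) (u, v)

end Entropy

/-- The two-file source with files `X i = (A i, V)`, where the pmf `q` is the joint law of the two
components `A 0`, `A 1` and of the common component `V`. -/
def overlapSource {A : Fin 2 → Type*} {B : Type*} [∀ i, Fintype (A i)] [∀ i, DecidableEq (A i)]
    [Fintype B] [DecidableEq B] (q : (∀ i, A i) × B → ℝ) : (∀ i, A i × B) → ℝ :=
  law q (fun s i => (s.1 i, s.2))

/-! ### The discrete memoryless source -/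

section Source

variable {X : Fin 2 → Type*} [∀ i, Fintype (X i)]

/-- Length-`F` source block; the `i`-th library file is `file x i`. -/
abbrev Block (X : Fin 2 → Type*) (F : ℕ) : Type _ := Fin F → ∀ i, X i

/-- The `i`-th file of a block. -/
def file {F : ℕ} (x : Block X F) (i : Fin 2) : Fin F → X i := fun t => x t i

/-- Expectation over `F` i.i.d. source symbols with pmf `p`. -/
def expect (p : (∀ i, X i) → ℝ) {F : ℕ} (f : Block X F → ℝ) : ℝ :=
  ∑ x : Block X F, (∏ t, p (x t)) * f x

open Classical in
/-- Probability of the event `E` over `F` i.i.d. source symbols with pmf `p`. -/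
noncomputable def prob (p : (∀ i, X i) → ℝ) {F : ℕ} (E : Block X F → Prop) : ℝ :=
  expect p (fun x => if E x then 1 else 0)

end Source

/-- Demands of `K` receivers: receiver `k` requests file `d k`. -/
abbrev Demand (K : ℕ) : Type := Fin K → Fin 2

/-- `limsup u ≤ r`. -/
def LimsupLE (u : ℕ → ℝ) (r : ℝ) : Prop :=
  ∀ ε > 0, ∀ᶠ n in atTop, u n ≤ r + ε

/-- The lower boundary `inf {R : (R, M) ∈ cl 𝒜}` of the closure of a set of rate-memory pairs. -/
noncomputable def rateMemoryFunction (𝒜 : Set (ℝ × ℝ)) (M : ℝ) : ℝ :=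
  sInf {R | (R, M) ∈ closure 𝒜}

/-! ### Cache-aided coded multicast (CACM) schemes -/

/-- A CACM scheme with `K` receivers, block length `F` and cache capacity `M`. The contents of a
cache form an index set of at most `2 ^ (M F)` elements; codewords are binary strings of variable
length. -/
structure CACMScheme (X : Fin 2 → Type*) (K F : ℕ) (M : ℝ) where
  cacheSize : ℕ
  cacheSize_le : (cacheSize : ℝ) ≤ 2 ^ (M * F)
  cache : Fin K → Block X F → Fin cacheSize
  multicast : Demand K → (Fin K → Fin cacheSize) → Block X F → List Bool
  decode : ∀ (k : Fin K) (d : Demand K), List Bool → Fin cacheSize → (Fin F → X (d k))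

namespace CACMScheme

variable {X : Fin 2 → Type*} [∀ i, Fintype (X i)] {K F : ℕ} {M : ℝ}

/-- The transmitted codeword `Y_d`. -/
def codeword (S : CACMScheme X K F M) (d : Demand K) (x : Block X F) : List Bool :=
  S.multicast d (fun k => S.cache k x) x

/-- Worst-case error probability over all demands. -/
noncomputable def errorProb (S : CACMScheme X K F M) (p : (∀ i, X i) → ℝ) : ℝ :=
  ⨆ d : Demand K, prob p (fun x => ∃ k, S.decode k d (S.codeword d x) (S.cache k x) ≠ file x (d k))

/-- Expected codeword length for the demand `d`, in bits. -/
def expectedLength (S : CACMScheme X K F M) (p : (∀ i, X i) → ℝ) (d : Demand K) : ℝ :=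
  expect p (fun x => ((S.codeword d x).length : ℝ))

/-- Peak multicast rate: worst case over demands. -/
noncomputable def peakRate (S : CACMScheme X K F M) (p : (∀ i, X i) → ℝ) : ℝ :=
  ⨆ d : Demand K, S.expectedLength p d / F

/-- Average multicast rate: the demand is uniform on all `2 ^ K` demands. -/
noncomputable def avgRate (S : CACMScheme X K F M) (p : (∀ i, X i) → ℝ) : ℝ :=
  (∑ d : Demand K, S.expectedLength p d) / 2 ^ K / F

end CACMScheme

section Optimal

variable {X : Fin 2 → Type*} [∀ i, Fintype (X i)]

/-- Achievable peak rate-memory pairs `(R, M)`. -/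
def peakAchievable (p : (∀ i, X i) → ℝ) (K : ℕ) : Set (ℝ × ℝ) :=
  {z | ∃ S : ∀ F : ℕ, CACMScheme X K F z.2,
    Tendsto (fun F => (S F).errorProb p) atTop (𝓝 0) ∧ LimsupLE (fun F => (S F).peakRate p) z.1}

/-- Achievable average rate-memory pairs `(R, M)`. -/
def avgAchievable (p : (∀ i, X i) → ℝ) (K : ℕ) : Set (ℝ × ℝ) :=
  {z | ∃ S : ∀ F : ℕ, CACMScheme X K F z.2,
    Tendsto (fun F => (S F).errorProb p) atTop (𝓝 0) ∧ LimsupLE (fun F => (S F).avgRate p) z.1}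

/-- The optimal peak rate-memory function `R*(M)`. -/
noncomputable def optimalPeak (p : (∀ i, X i) → ℝ) (K : ℕ) (M : ℝ) : ℝ :=
  rateMemoryFunction (peakAchievable p K) M

/-- The optimal average rate-memory function. -/
noncomputable def optimalAvg (p : (∀ i, X i) → ℝ) (K : ℕ) (M : ℝ) : ℝ :=
  rateMemoryFunction (avgAchievable p K) M

end Optimal

/-! ### The Gray-Wyner network -/

/-- A Gray-Wyner code of block length `F`: a common description `W₀` with at most `2 ^ (F ρ₀)`
values, private descriptions `W₁`, `W₂` with at most `2 ^ (F ρ₁)`, `2 ^ (F ρ₂)` values; file `i` is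
reconstructed from the common and from its own private description.
Here `ρ = (ρ₀, ![ρ₁, ρ₂])`. -/
structure GWCode (X : Fin 2 → Type*) (F : ℕ) (ρ : ℝ × (Fin 2 → ℝ)) where
  commonSize : ℕ
  privSize : Fin 2 → ℕ
  commonSize_le : (commonSize : ℝ) ≤ 2 ^ (F * ρ.1)
  privSize_le : ∀ i, (privSize i : ℝ) ≤ 2 ^ (F * ρ.2 i)
  encCommon : Block X F → Fin commonSize
  encPriv : ∀ i, Block X F → Fin (privSize i)
  decode : ∀ i, Fin commonSize → Fin (privSize i) → (Fin F → X i)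

section GW

variable {X : Fin 2 → Type*} [∀ i, Fintype (X i)]

/-- Probability that some file is reconstructed incorrectly. -/
noncomputable def GWCode.errorProb {F : ℕ} {ρ : ℝ × (Fin 2 → ℝ)} (C : GWCode X F ρ)
    (p : (∀ i, X i) → ℝ) : ℝ :=
  prob p (fun x => ∃ i, C.decode i (C.encCommon x) (C.encPriv i x) ≠ file x i)

/-- The Gray-Wyner rate region: closure of the set of rate triples that allow asymptotically
lossless reconstruction of both files. -/
def gwRegion (p : (∀ i, X i) → ℝ) : Set (ℝ × (Fin 2 → ℝ)) :=
  closure {ρ | ∃ C : ∀ F : ℕ, GWCode X F ρ, Tendsto (fun F => (C F).errorProb p) atTop (𝓝 0)}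

end GW

/-! ### Caching schemes for the private sublibrary -/

/-- A (correlation-unaware, zero-error) caching scheme for two bit strings `w 0`, `w 1`, of any
lengths: every receiver fills its cache, and for each demand `d` one common codeword is sent from
which, together with its cache, receiver `k` recovers `w (d k)`. The numbers of cached and of
transmitted bits depend on the lengths of the two strings only. -/
structure PrivateScheme (K : ℕ) where
  place : Fin K → (Fin 2 → List Bool) → List Bool
  deliver : Demand K → (Fin 2 → List Bool) → List Bool
  cacheBits : (Fin 2 → ℕ) → ℕ
  codeBits : Demand K → (Fin 2 → ℕ) → ℕ
  place_length : ∀ k w, (place k w).length = cacheBits (fun i => (w i).length)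
  deliver_length : ∀ d w, (deliver d w).length = codeBits d (fun i => (w i).length)
  decodable : ∀ d k w w', (∀ i, (w i).length = (w' i).length) →
    place k w = place k w' → deliver d w = deliver d w' → w (d k) = w' (d k)

/-- Bitwise exclusive or of strings of equal length. -/
def xorBits (a b : List Bool) : List Bool := List.zipWith Bool.xor a b

/-- Packet `j` of size `s`. -/
def packet (s j : ℕ) (l : List Bool) : List Bool := (l.drop (j * s)).take s

/-- What remains of a string after its first `K` packets of size `s`. -/
def leftover (K s : ℕ) (l : List Bool) : List Bool := l.drop (K * s)

/-- Size of a packet: the shorter string is cut into `K` packets (up to rounding). -/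
def packetSize (K : ℕ) (n : Fin 2 → ℕ) : ℕ := min (n 0) (n 1) / K

/-- Packet size for the strings `w`. -/
def pSize (K : ℕ) (w : Fin 2 → List Bool) : ℕ := packetSize K (fun i => (w i).length)

theorem xorBits_length {a b : List Bool} {s : ℕ} (ha : a.length = s) (hb : b.length = s) :
    (xorBits a b).length = s := by
  simp [xorBits, ha, hb]

theorem xorBits_left_cancel : ∀ {a b b' : List Bool}, a.length = b.length → a.length = b'.length →
    xorBits a b = xorBits a b' → b = b'
  | [], [], [], _, _, _ => rfl
  | x :: a, y :: b, z :: b', h, h', e => by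
    simp only [xorBits, List.zipWith_cons_cons, List.cons.injEq] at e
    simp only [List.length_cons, Nat.add_right_cancel_iff] at h h'
    rw [xorBits_left_cancel h h' e.2]
    have := e.1
    revert this
    cases x <;> cases y <;> cases z <;> simp

theorem xorBits_comm (a b : List Bool) : xorBits a b = xorBits b a :=
  List.zipWith_comm_of_comm (fun x y => Bool.xor_comm x y)

theorem xorBits_right_cancel {a b b' : List Bool} (h : a.length = b.length)
    (h' : a.length = b'.length) (e : xorBits b a = xorBits b' a) : b = b' :=
  xorBits_left_cancel h h' (by rwa [xorBits_comm a b, xorBits_comm a b'])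

theorem packetSize_le {K : ℕ} (n : Fin 2 → ℕ) (i : Fin 2) : K * packetSize K n ≤ n i := by
  have h : K * packetSize K n ≤ min (n 0) (n 1) := Nat.mul_div_le _ _
  fin_cases i
  · exact h.trans (min_le_left _ _)
  · exact h.trans (min_le_right _ _)

theorem packet_length {K s j : ℕ} {l : List Bool} (h : K * s ≤ l.length) (hj : j < K) :
    (packet s j l).length = s := by
  have : (j + 1) * s ≤ l.length := (Nat.mul_le_mul_right s hj).trans h
  simp only [packet, List.length_take, List.length_drop]
  rw [Nat.add_mul] at this
  omega

theorem packet_pSize_length {K : ℕ} (w : Fin 2 → List Bool) (i : Fin 2) (k : Fin K) :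
    (packet (pSize K w) k (w i)).length = pSize K w :=
  packet_length (packetSize_le _ i) k.2

theorem leftover_pSize_length {K : ℕ} (w : Fin 2 → List Bool) (i : Fin 2) :
    (leftover K (pSize K w) (w i)).length = (w i).length - K * pSize K w := by
  simp [leftover]

theorem eq_of_packets {K s : ℕ} {l l' : List Bool}
    (hp : ∀ k : Fin K, packet s k l = packet s k l') (hr : leftover K s l = leftover K s l') :
    l = l' := by
  have key : ∀ m, m ≤ K → l.take (m * s) = l'.take (m * s) := by
    intro m
    induction m with
    | zero => simp
    | succ m ih =>
      intro hm
      have h := hp ⟨m, hm⟩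
      simp only [packet] at h
      rw [Nat.add_mul, one_mul, List.take_add, List.take_add, ih (by omega), h]
  rw [← List.take_append_drop (K * s) l, ← List.take_append_drop (K * s) l', key K le_rfl]
  exact congrArg _ hr

theorem pSize_congr {K : ℕ} {w w' : Fin 2 → List Bool}
    (h : ∀ i, (w i).length = (w' i).length) : pSize K w = pSize K w' := by
  simp [pSize, h]

/-- If strings of equal lengths are concatenated, the concatenation determines each of them. -/
theorem flatMap_inj {α : Type*} {L : List α} {f f' : α → List Bool}
    (hl : ∀ a ∈ L, (f a).length = (f' a).length) (h : L.flatMap f = L.flatMap f') :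
    ∀ a ∈ L, f a = f' a := by
  induction L with
  | nil => simp
  | cons b L ih =>
    simp only [List.flatMap_cons] at h
    obtain ⟨h1, h2⟩ := List.append_inj h (hl b (by simp))
    intro a ha
    rcases List.mem_cons.1 ha with rfl | ha
    · exact h1
    · exact ih (fun a ha => hl a (by simp [ha])) h2 a ha

theorem flatMap_length {α : Type*} {L : List α} {f : α → List Bool} {s : ℕ}
    (hl : ∀ a ∈ L, (f a).length = s) : (L.flatMap f).length = L.length * s := by
  induction L with
  | nil => simp
  | cons b L ih =>
    simp only [List.flatMap_cons, List.length_append, List.length_cons]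
    rw [hl b (by simp), ih (fun a ha => hl a (by simp [ha])), Nat.add_mul, one_mul, add_comm]

/-- File `i` is requested by at least one receiver. -/
def Requested {K : ℕ} (d : Demand K) (i : Fin 2) : Prop := ∃ k, d k = i

instance {K : ℕ} (d : Demand K) (i : Fin 2) : Decidable (Requested d i) :=
  inferInstanceAs (Decidable (∃ k, d k = i))

/-- The strings `f i` of all requested files `i`, uncoded. -/
def requestedPart {K : ℕ} (d : Demand K) (f : Fin 2 → List Bool) : List Bool :=
  (if Requested d 0 then f 0 else []) ++ (if Requested d 1 then f 1 else [])

/-- Total size of the requested parts. -/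
def requestedBits {K : ℕ} (d : Demand K) (n : Fin 2 → ℕ) : ℕ :=
  (if Requested d 0 then n 0 else 0) + (if Requested d 1 then n 1 else 0)

theorem requestedPart_length {K : ℕ} (d : Demand K) (f : Fin 2 → List Bool) :
    (requestedPart d f).length = requestedBits d (fun i => (f i).length) := by
  unfold requestedPart requestedBits
  split_ifs <;> simp

theorem requestedPart_inj {K : ℕ} {d : Demand K} {f f' : Fin 2 → List Bool}
    (hl : ∀ i, (f i).length = (f' i).length) (h : requestedPart d f = requestedPart d f')
    (k : Fin K) : f (d k) = f' (d k) := by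
  unfold requestedPart at h
  obtain ⟨h0, h1⟩ := List.append_inj h (by split_ifs <;> simp [hl])
  have hk : Requested d (d k) := ⟨k, rfl⟩
  generalize d k = i at hk ⊢
  fin_cases i
  · have hk' : Requested d 0 := hk
    rw [if_pos hk', if_pos hk'] at h0
    exact h0
  · have hk' : Requested d 1 := hk
    rw [if_pos hk', if_pos hk'] at h1
    exact h1

/-- The leader of a demanded file is the first receiver that requests it. -/
def IsLeader {K : ℕ} (d : Demand K) (k : Fin K) : Prop := ∀ j < k, d j ≠ d k

instance {K : ℕ} (d : Demand K) (k : Fin K) : Decidable (IsLeader d k) :=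
  inferInstanceAs (Decidable (∀ j < k, d j ≠ d k))

theorem exists_leader {K : ℕ} (d : Demand K) (k : Fin K) :
    ∃ u, IsLeader d u ∧ d u = d k ∧ u ≤ k := by
  induction k using WellFoundedLT.induction with
  | ind k ih =>
    by_cases h : IsLeader d k
    · exact ⟨k, h, rfl, le_rfl⟩
    · simp only [IsLeader, not_forall, not_not] at h
      obtain ⟨j, hj, e⟩ := h
      obtain ⟨u, hu, hu', hle⟩ := ih j hj
      exact ⟨u, hu, hu'.trans e, hle.trans hj.le⟩

/-- Pairs of receivers satisfying a condition, in a fixed order. -/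
def pairsWith {K : ℕ} (P : Fin K → Fin K → Prop) [∀ a b, Decidable (P a b)] :
    List (Fin K × Fin K) :=
  (List.finRange K ×ˢ List.finRange K).filter (fun z => P z.1 z.2)

theorem mem_pairsWith {K : ℕ} {P : Fin K → Fin K → Prop} [∀ a b, Decidable (P a b)]
    {z : Fin K × Fin K} : z ∈ pairsWith P ↔ P z.1 z.2 := by
  obtain ⟨a, b⟩ := z
  have h : (a, b) ∈ List.finRange K ×ˢ List.finRange K := List.pair_mem_product.2 (by simp)
  simp [pairsWith, h]

/-- No caching: the requested strings are sent uncoded. -/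
def noCaching (K : ℕ) : PrivateScheme K where
  place _ _ := []
  deliver d w := requestedPart d w
  cacheBits _ := 0
  codeBits d n := requestedBits d n
  place_length _ _ := rfl
  deliver_length d w := requestedPart_length d w
  decodable _ k _ _ hl _ h := requestedPart_inj hl h k

/-- Full caching: both strings are stored by all receivers, nothing is sent. -/
def fullCaching (K : ℕ) : PrivateScheme K where
  place _ w := w 0 ++ w 1
  deliver _ _ := []
  cacheBits n := n 0 + n 1
  codeBits _ _ := 0
  place_length _ w := by simp
  deliver_length _ _ := rfl
  decodable d k w w' hl h _ := by
    obtain ⟨h0, h1⟩ := List.append_inj h (hl 0)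
    generalize d k = i
    fin_cases i
    · exact h0
    · exact h1

/-- The pairs (leader, other receiver with the same request). -/
def samePairs {K : ℕ} (d : Demand K) : List (Fin K × Fin K) :=
  pairsWith (fun u j => IsLeader d u ∧ u < j ∧ d j = d u)

/-- The coded part of the delivery of `codedCaching` when both files are requested: from the packet
that receiver `k` did not request, each receiver resolves its own cached combination; then the
packets of the receivers that request the same file are exchanged through the leader. -/
def codedDelivery {K : ℕ} (d : Demand K) (w : Fin 2 → List Bool) : List Bool :=
  (List.finRange K).flatMap (fun k : Fin K => packet (pSize K w) k (w (1 - d k))) ++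
  (samePairs d).flatMap (fun z =>
    xorBits (packet (pSize K w) z.1 (w (d z.1))) (packet (pSize K w) z.2 (w (d z.1))))

theorem codedDelivery_length {K : ℕ} (d : Demand K) (w : Fin 2 → List Bool) :
    (codedDelivery d w).length = (K + (samePairs d).length) * pSize K w := by
  unfold codedDelivery
  rw [List.length_append, flatMap_length (s := pSize K w), flatMap_length (s := pSize K w),
    List.length_finRange, Nat.add_mul]
  · exact fun z _ => xorBits_length (packet_pSize_length _ _ _) (packet_pSize_length _ _ _)
  · exact fun k _ => packet_pSize_length _ _ _

/-- Small memory, coded placement: the strings are cut into `K` packets each (and a leftover), and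
receiver `k` stores the exclusive or of the two `k`-th packets. If all receivers request the same
file, it is sent uncoded. -/
def codedCaching (K : ℕ) : PrivateScheme K where
  place k w := xorBits (packet (pSize K w) k (w 0)) (packet (pSize K w) k (w 1))
  deliver d w :=
    if Requested d 0 ∧ Requested d 1 then
      codedDelivery d w ++ (leftover K (pSize K w) (w 0) ++ leftover K (pSize K w) (w 1))
    else requestedPart d w
  cacheBits n := packetSize K n
  codeBits d n :=
    if Requested d 0 ∧ Requested d 1 then
      (K + (samePairs d).length) * packetSize K n +
        ((n 0 - K * packetSize K n) + (n 1 - K * packetSize K n))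
    else requestedBits d n
  place_length k w :=
    xorBits_length (packet_pSize_length w 0 k) (packet_pSize_length w 1 k)
  deliver_length d w := by
    split_ifs
    · rw [List.length_append, List.length_append, codedDelivery_length, leftover_pSize_length,
        leftover_pSize_length]
      rfl
    · exact requestedPart_length d w
  decodable d k w w' hl hc hy := by
    have hs : pSize K w = pSize K w' := pSize_congr hl
    by_cases hr : Requested d 0 ∧ Requested d 1
    swap
    · simp only [hr, if_false] at hy
      exact requestedPart_inj hl hy k
    simp only [hr, and_self, if_true] at hy
    obtain ⟨h1, h2⟩ := List.append_inj hy (by rw [codedDelivery_length, codedDelivery_length, hs])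
    obtain ⟨l0, l1⟩ := List.append_inj h2
      (by rw [leftover_pSize_length, leftover_pSize_length, hs, hl])
    unfold codedDelivery at h1
    obtain ⟨ha, hb⟩ := List.append_inj h1 (by
      rw [flatMap_length (s := pSize K w), flatMap_length (s := pSize K w)]
      · exact fun k _ => by rw [packet_pSize_length, hs]
      · exact fun k _ => packet_pSize_length _ _ _)
    have plen : ∀ i (j : Fin K), (packet (pSize K w) j (w i)).length = pSize K w :=
      fun i j => packet_pSize_length w i j
    have plen' : ∀ i (j : Fin K), (packet (pSize K w) j (w' i)).length = pSize K w :=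
      fun i j => by rw [hs]; exact packet_pSize_length w' i j
    rw [← hs] at ha hb l0 l1 hc
    have ha' : ∀ j : Fin K, packet (pSize K w) j (w (1 - d j)) =
        packet (pSize K w) j (w' (1 - d j)) := fun j =>
      flatMap_inj (fun j _ => by rw [plen, plen']) ha j (by simp)
    have hb' := flatMap_inj (fun z _ => by
      rw [xorBits_length (plen _ _) (plen _ _), xorBits_length (plen' _ _) (plen' _ _)]) hb
    -- the own packet
    have hown : packet (pSize K w) k (w (d k)) = packet (pSize K w) k (w' (d k)) := by
      have hk := ha' k
      revert hk
      generalize d k = i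
      fin_cases i
      · intro hk
        simp only [Fin.zero_eta, Fin.isValue, sub_zero] at hk ⊢
        rw [hk] at hc
        exact xorBits_right_cancel ((plen' _ _).trans (plen _ _).symm)
          ((plen' _ _).trans (plen' _ _).symm) hc
      · intro hk
        simp only [Fin.mk_one, Fin.isValue, sub_self] at hk ⊢
        rw [hk] at hc
        exact xorBits_left_cancel ((plen' _ _).trans (plen _ _).symm)
          ((plen' _ _).trans (plen' _ _).symm) hc
    obtain ⟨u, hu, hud, huk⟩ := exists_leader d k
    -- the packet of the leader
    have hlead : packet (pSize K w) u (w (d k)) = packet (pSize K w) u (w' (d k)) := by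
      rcases huk.eq_or_lt with rfl | hlt
      · exact hown
      · have := hb' (u, k) (mem_pairsWith.2 ⟨hu, hlt, hud.symm⟩)
        simp only [hud] at this
        rw [hown] at this
        exact xorBits_right_cancel ((plen' _ _).trans (plen _ _).symm)
          ((plen' _ _).trans (plen' _ _).symm) this
    refine eq_of_packets (K := K) (s := pSize K w) (fun j => ?_) ?_
    · by_cases hj : d j = d k
      · obtain ⟨v, hv, hvd, hvj⟩ := exists_leader d j
        have huv : u = v := by
          rcases lt_trichotomy u v with h | h | h
          · exact absurd (hud.trans (hj.symm.trans hvd.symm)) (hv u h)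
          · exact h
          · exact absurd (hvd.trans (hj.trans hud.symm)) (hu v h)
        subst huv
        rcases hvj.eq_or_lt with rfl | hlt
        · exact hlead
        · have := hb' (u, j) (mem_pairsWith.2 ⟨hu, hlt, hvd.symm⟩)
          simp only [hud] at this
          rw [hlead] at this
          exact xorBits_left_cancel ((plen' _ _).trans (plen _ _).symm)
            ((plen' _ _).trans (plen' _ _).symm) this
      · have h := ha' j
        have e : 1 - d j = d k := by
          revert hj
          generalize d j = a
          generalize d k = b
          revert a b
          decide
        rwa [e] at h
    · generalize d k = i
      fin_cases i
      · exact l0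
      · exact l1

/-- The pairs of distinct receivers that contain a leader. -/
def leaderPairs {K : ℕ} (d : Demand K) : List (Fin K × Fin K) :=
  pairsWith (fun k j => k < j ∧ (IsLeader d k ∨ IsLeader d j))

/-- Small memory, uncoded placement: receiver `k` stores the two `k`-th packets. For each pair
`k, j` of receivers that contains a leader, the exclusive or of the packet `j` requested by `k` and
of the packet `k` requested by `j` is sent; requested leftovers are sent uncoded. -/
def uncodedCaching (K : ℕ) : PrivateScheme K where
  place k w := packet (pSize K w) k (w 0) ++ packet (pSize K w) k (w 1)
  deliver d w :=
    (leaderPairs d).flatMap (fun z =>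
      xorBits (packet (pSize K w) z.2 (w (d z.1))) (packet (pSize K w) z.1 (w (d z.2)))) ++
    requestedPart d (fun i => leftover K (pSize K w) (w i))
  cacheBits n := packetSize K n + packetSize K n
  codeBits d n := (leaderPairs d).length * packetSize K n +
    requestedBits d (fun i => n i - K * packetSize K n)
  place_length k w := by
    rw [List.length_append, packet_pSize_length, packet_pSize_length]; rfl
  deliver_length d w := by
    rw [List.length_append, flatMap_length (s := pSize K w), requestedPart_length]
    · simp only [leftover_pSize_length]; rfl
    · exact fun z _ => xorBits_length (packet_pSize_length _ _ _) (packet_pSize_length _ _ _)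
  decodable d k w w' hl hc hy := by
    have hs : pSize K w = pSize K w' := pSize_congr hl
    have plen : ∀ i (j : Fin K), (packet (pSize K w) j (w i)).length = pSize K w :=
      fun i j => packet_pSize_length w i j
    have plen' : ∀ i (j : Fin K), (packet (pSize K w) j (w' i)).length = pSize K w :=
      fun i j => by rw [hs]; exact packet_pSize_length w' i j
    rw [← hs] at hc hy
    obtain ⟨hx, hr⟩ := List.append_inj hy (by
      rw [flatMap_length (s := pSize K w), flatMap_length (s := pSize K w)]
      · exact fun z _ => xorBits_length (plen' _ _) (plen' _ _)
      · exact fun z _ => xorBits_length (plen _ _) (plen _ _))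
    have hx' := flatMap_inj (fun z _ => by
      rw [xorBits_length (plen _ _) (plen _ _), xorBits_length (plen' _ _) (plen' _ _)]) hx
    obtain ⟨c0, c1⟩ := List.append_inj hc (by rw [plen, plen'])
    have hown : ∀ i, packet (pSize K w) k (w i) = packet (pSize K w) k (w' i) := by
      intro i
      fin_cases i
      · exact c0
      · exact c1
    have hpair : ∀ a b : Fin K, a ≠ b → (IsLeader d a ∨ IsLeader d b) →
        xorBits (packet (pSize K w) b (w (d a))) (packet (pSize K w) a (w (d b))) =
        xorBits (packet (pSize K w) b (w' (d a))) (packet (pSize K w) a (w' (d b))) := by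
      intro a b hab hL
      rcases lt_or_gt_of_ne hab with h | h
      · exact hx' (a, b) (mem_pairsWith.2 ⟨h, hL⟩)
      · have := hx' (b, a) (mem_pairsWith.2 ⟨h, hL.symm⟩)
        rw [xorBits_comm, xorBits_comm (packet (pSize K w) b (w' (d a)))]
        exact this
    -- one of the two packets of a pair determines the other
    have hstep : ∀ a b : Fin K, a ≠ b → (IsLeader d a ∨ IsLeader d b) →
        packet (pSize K w) a (w (d b)) = packet (pSize K w) a (w' (d b)) →
        packet (pSize K w) b (w (d a)) = packet (pSize K w) b (w' (d a)) := by
      intro a b hab hL h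
      have := hpair a b hab hL
      rw [h] at this
      exact xorBits_right_cancel ((plen' _ _).trans (plen _ _).symm)
        ((plen' _ _).trans (plen' _ _).symm) this
    obtain ⟨u, hu, hud, -⟩ := exists_leader d k
    refine eq_of_packets (K := K) (s := pSize K w) (fun j => ?_) ?_
    · by_cases hjk : j = k
      · subst hjk; exact hown _
      by_cases hju : j = u
      · subst hju
        exact hstep k j (Ne.symm hjk) (Or.inr hu) (hown _)
      rw [← hud]
      refine hstep u j (Ne.symm hju) (Or.inl hu) ?_
      -- now the packet of the leader `u` in the file requested by `j`
      obtain ⟨v, hv, hvd, -⟩ := exists_leader d j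
      rw [← hvd]
      by_cases hvu : v = u
      · subst hvu
        by_cases hkv : k = v
        · subst hkv; exact hown _
        · rw [hud]
          exact hstep k v hkv (Or.inr hv) (hown _)
      · refine hstep v u hvu (Or.inl hv) ?_
        rw [hud]
        by_cases hkv : k = v
        · subst hkv; exact hown _
        · exact hstep k v hkv (Or.inr hv) (hown _)
    · exact requestedPart_inj (f := fun i => leftover K (pSize K w) (w i))
        (f' := fun i => leftover K (pSize K w) (w' i))
        (fun i => by simp [leftover, hl]) hr k

/-- The exclusive or of the strings `f k` of length `s`, over a list of receivers. -/
def xorAll {α : Type*} (s : ℕ) (f : α → List Bool) (L : List α) : List Bool :=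
  L.foldr (fun k acc => xorBits (f k) acc) (List.replicate s false)

theorem xorAll_length {α : Type*} {s : ℕ} {f : α → List Bool} (hf : ∀ a, (f a).length = s)
    (L : List α) : (xorAll s f L).length = s := by
  induction L with
  | nil => simp [xorAll]
  | cons a L ih => exact xorBits_length (hf a) ih

theorem xorAll_congr {α : Type*} {s : ℕ} {f f' : α → List Bool} {L : List α}
    (h : ∀ a ∈ L, f a = f' a) : xorAll s f L = xorAll s f' L := by
  induction L with
  | nil => rfl
  | cons a L ih =>
    change xorBits (f a) (xorAll s f L) = xorBits (f' a) (xorAll s f' L)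
    rw [h a (by simp), ih (fun b hb => h b (by simp [hb]))]

theorem xorAll_inj {α : Type*} {s : ℕ} {f f' : α → List Bool} (hf : ∀ a, (f a).length = s)
    (hf' : ∀ a, (f' a).length = s) {k : α} : ∀ {L : List α}, L.Nodup → k ∈ L →
    (∀ a, a ≠ k → f a = f' a) → xorAll s f L = xorAll s f' L → f k = f' k
  | [], _, h, _, _ => by simp at h
  | a :: L, hn, hk, h, e => by
    have e' : xorBits (f a) (xorAll s f L) = xorBits (f' a) (xorAll s f' L) := e
    rw [List.nodup_cons] at hn
    by_cases hak : a = k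
    · subst hak
      rw [xorAll_congr (f := f) (f' := f')
        (fun b hb => h b (fun hba => hn.1 (hba ▸ hb)))] at e'
      exact xorBits_right_cancel ((xorAll_length hf' L).trans (hf a).symm)
        ((xorAll_length hf' L).trans (hf' a).symm) e'
    · rw [h a hak] at e'
      have hk' : k ∈ L := by
        rcases List.mem_cons.1 hk with h1 | h1
        · exact absurd h1.symm hak
        · exact h1
      exact xorAll_inj hf hf' hn.2 hk' h
        (xorBits_left_cancel ((hf' a).trans (xorAll_length hf L).symm)
          ((hf' a).trans (xorAll_length hf' L).symm) e')

/-- The receivers other than `k`. -/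
def others {K : ℕ} (k : Fin K) : List (Fin K) := (List.finRange K).filter (fun j => j ≠ k)

theorem others_length {K : ℕ} (k : Fin K) : (others k).length = K - 1 := by
  have hn : (others k).Nodup := (List.nodup_finRange K).filter _
  rw [← List.toFinset_card_of_nodup hn]
  have : (others k).toFinset = Finset.univ.erase k := by
    ext j; simp [others]
  rw [this, Finset.card_erase_of_mem (Finset.mem_univ _), Finset.card_univ, Fintype.card_fin]

/-- Large memory: receiver `k` stores everything except the two `k`-th packets, and the exclusive
or over all `k` of the `k`-th packet of the file requested by receiver `k` is sent. -/
def allButOneCaching (K : ℕ) : PrivateScheme K where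
  place k w :=
    (others k).flatMap (fun j : Fin K => packet (pSize K w) j (w 0)) ++
    ((others k).flatMap (fun j : Fin K => packet (pSize K w) j (w 1)) ++
    (leftover K (pSize K w) (w 0) ++ leftover K (pSize K w) (w 1)))
  deliver d w := xorAll (pSize K w) (fun k : Fin K => packet (pSize K w) k (w (d k))) (List.finRange K)
  cacheBits n := (K - 1) * packetSize K n + ((K - 1) * packetSize K n +
    ((n 0 - K * packetSize K n) + (n 1 - K * packetSize K n)))
  codeBits _ n := packetSize K n
  place_length k w := by
    simp only [List.length_append]
    rw [flatMap_length (s := pSize K w) (fun j _ => packet_pSize_length _ _ _),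
      flatMap_length (s := pSize K w) (fun j _ => packet_pSize_length _ _ _), others_length,
      leftover_pSize_length, leftover_pSize_length]
    rfl
  deliver_length d w := xorAll_length (fun k => packet_pSize_length _ _ _) _
  decodable d k w w' hl hc hy := by
    have hs : pSize K w = pSize K w' := pSize_congr hl
    have plen : ∀ i (j : Fin K), (packet (pSize K w) j (w i)).length = pSize K w :=
      fun i j => packet_pSize_length w i j
    have plen' : ∀ i (j : Fin K), (packet (pSize K w) j (w' i)).length = pSize K w :=
      fun i j => by rw [hs]; exact packet_pSize_length w' i j
    rw [← hs] at hc hy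
    obtain ⟨h0, hc⟩ := List.append_inj hc (by
      rw [flatMap_length (s := pSize K w) (fun j _ => plen _ _),
        flatMap_length (s := pSize K w) (fun j _ => plen' _ _)])
    obtain ⟨h1, hc⟩ := List.append_inj hc (by
      rw [flatMap_length (s := pSize K w) (fun j _ => plen _ _),
        flatMap_length (s := pSize K w) (fun j _ => plen' _ _)])
    obtain ⟨l0, l1⟩ := List.append_inj hc (by simp [leftover, hl])
    have h0' := flatMap_inj (fun j _ => by rw [plen, plen']) h0
    have h1' := flatMap_inj (fun j _ => by rw [plen, plen']) h1
    have hoth : ∀ i, ∀ j : Fin K, j ≠ k →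
        packet (pSize K w) j (w i) = packet (pSize K w) j (w' i) := by
      intro i j hj
      have hm : j ∈ others k := by simp [others, hj]
      fin_cases i
      · exact h0' j hm
      · exact h1' j hm
    refine eq_of_packets (K := K) (s := pSize K w) (fun j => ?_) ?_
    · by_cases hjk : j = k
      · subst hjk
        exact xorAll_inj (f := fun k : Fin K => packet (pSize K w) k (w (d k)))
          (f' := fun k : Fin K => packet (pSize K w) k (w' (d k))) (fun _ => plen _ _) (fun _ => plen' _ _)
          (List.nodup_finRange K) (by simp) (fun a ha => hoth _ a ha) hy
      · exact hoth _ j hjk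
    · generalize d k = i
      fin_cases i
      · exact l0
      · exact l1

/-- Number of bits in the first part when a string of length `n` is divided in proportion
`t : 1 - t`. -/
noncomputable def cut (t : ℝ) (n : ℕ) : ℕ := ⌊t * n⌋₊

/-- Memory sharing: a fraction `t` of both strings is cached and delivered with `P`, the rest
with `Q`. -/
noncomputable def memoryShare {K : ℕ} (t : ℝ) (P Q : PrivateScheme K) : PrivateScheme K where
  place k w := P.place k (fun i => (w i).take (cut t (w i).length)) ++
    Q.place k (fun i => (w i).drop (cut t (w i).length))
  deliver d w := P.deliver d (fun i => (w i).take (cut t (w i).length)) ++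
    Q.deliver d (fun i => (w i).drop (cut t (w i).length))
  cacheBits n := P.cacheBits (fun i => min (cut t (n i)) (n i)) +
    Q.cacheBits (fun i => n i - cut t (n i))
  codeBits d n := P.codeBits d (fun i => min (cut t (n i)) (n i)) +
    Q.codeBits d (fun i => n i - cut t (n i))
  place_length k w := by simp [P.place_length, Q.place_length]
  deliver_length d w := by simp [P.deliver_length, Q.deliver_length]
  decodable d k w w' hl hc hy := by
    obtain ⟨c1, c2⟩ := List.append_inj hc (by simp [P.place_length, hl])
    obtain ⟨y1, y2⟩ := List.append_inj hy (by simp [P.deliver_length, hl])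
    have h1 := P.decodable d k _ _ (by simp [hl]) c1 y1
    have h2 := Q.decodable d k _ _ (by simp [hl]) c2 y2
    rw [← List.take_append_drop (cut t (w (d k)).length) (w (d k)), h1, h2,
      List.take_append_drop]

/-- All schemes obtained from a set `𝒞` of schemes by repeated memory sharing. -/
inductive MemorySharing {K : ℕ} (𝒞 : Set (PrivateScheme K)) : PrivateScheme K → Prop
  | base (P : PrivateScheme K) : P ∈ 𝒞 → MemorySharing 𝒞 P
  | share (t : ℝ) (P Q : PrivateScheme K) : t ∈ Set.Icc (0 : ℝ) 1 →
      MemorySharing 𝒞 P → MemorySharing 𝒞 Q → MemorySharing 𝒞 (memoryShare t P Q)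

/-- The schemes adopted for the private sublibrary under the peak rate criterion. -/
def peakPrivate (K : ℕ) : Set (PrivateScheme K) :=
  {P | MemorySharing {noCaching K, codedCaching K, allButOneCaching K, fullCaching K} P}

/-- The schemes adopted for the private sublibrary under the average rate criterion. -/
def avgPrivate (K : ℕ) : Set (PrivateScheme K) :=
  {P | MemorySharing {noCaching K, uncodedCaching K, allButOneCaching K, fullCaching K} P}

/-! ### Multiple-request (MR) schemes and the proposed GW-MR scheme -/

/-- A zero-error multiple-request scheme for a common description `w₀` and private descriptions
`w 0`, `w 1`: receiver `k` recovers `w₀` and `w (d k)`. -/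
structure MRScheme (K : ℕ) where
  place : Fin K → List Bool → (Fin 2 → List Bool) → List Bool
  deliver : Demand K → List Bool → (Fin 2 → List Bool) → List Bool
  cacheBits : ℕ → (Fin 2 → ℕ) → ℕ
  codeBits : Demand K → ℕ → (Fin 2 → ℕ) → ℕ
  place_length : ∀ k w₀ w, (place k w₀ w).length = cacheBits w₀.length (fun i => (w i).length)
  deliver_length : ∀ d w₀ w,
    (deliver d w₀ w).length = codeBits d w₀.length (fun i => (w i).length)
  decodable : ∀ d k w₀ w₀' w w', w₀.length = w₀'.length → (∀ i, (w i).length = (w' i).length) →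
    place k w₀ w = place k w₀' w' → deliver d w₀ w = deliver d w₀' w' →
    w₀ = w₀' ∧ w (d k) = w' (d k)

/-- The proposed MR scheme: the first `m` bits of the common description are stored by all
receivers and its other bits are sent uncoded; the private descriptions are, independently, cached
and delivered with `P`. -/
def proposedMR {K : ℕ} (m : ℕ) (P : PrivateScheme K) : MRScheme K where
  place k w₀ w := w₀.take m ++ P.place k w
  deliver d w₀ w := w₀.drop m ++ P.deliver d w
  cacheBits n₀ n := min m n₀ + P.cacheBits n
  codeBits d n₀ n := (n₀ - m) + P.codeBits d n
  place_length k w₀ w := by simp [P.place_length]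
  deliver_length d w₀ w := by simp [P.deliver_length]
  decodable d k w₀ w₀' w w' h₀ hl hc hy := by
    obtain ⟨c1, c2⟩ := List.append_inj hc (by simp [h₀])
    obtain ⟨y1, y2⟩ := List.append_inj hy (by simp [h₀])
    refine ⟨?_, P.decodable d k w w' hl c2 y2⟩
    rw [← List.take_append_drop m w₀, c1, y1, List.take_append_drop]

/-- Number of bits of a description of rate `r` at block length `F`. -/
noncomputable def descBits (r : ℝ) (F : ℕ) : ℕ := ⌈F * r⌉₊

namespace MRScheme

variable {K : ℕ}

/-- Cached bits per receiver at block length `F` and Gray-Wyner rates `ρ`. -/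
noncomputable def cacheLoad (S : MRScheme K) (ρ : ℝ × (Fin 2 → ℝ)) (F : ℕ) : ℕ :=
  S.cacheBits (descBits ρ.1 F) (fun i => descBits (ρ.2 i) F)

/-- Transmitted bits for the demand `d` at block length `F` and Gray-Wyner rates `ρ`. -/
noncomputable def codeLoad (S : MRScheme K) (ρ : ℝ × (Fin 2 → ℝ)) (F : ℕ) (d : Demand K) : ℕ :=
  S.codeBits d (descBits ρ.1 F) (fun i => descBits (ρ.2 i) F)

/-- Peak rate of an MR scheme. -/
noncomputable def peakRate (S : MRScheme K) (ρ : ℝ × (Fin 2 → ℝ)) (F : ℕ) : ℝ :=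
  ⨆ d : Demand K, (S.codeLoad ρ F d : ℝ) / F

/-- Average rate of an MR scheme over uniform demands. -/
noncomputable def avgRate (S : MRScheme K) (ρ : ℝ × (Fin 2 → ℝ)) (F : ℕ) : ℝ :=
  (∑ d : Demand K, (S.codeLoad ρ F d : ℝ)) / 2 ^ K / F

end MRScheme

/-- Peak rate-memory pairs `(R, M)` achieved by the proposed MR scheme when the Gray-Wyner network
operates at `ρ`, for some division of the memory between the common description (share `μ₀`) and
the private sublibrary. -/
def proposedPeakAchievable (K : ℕ) (ρ : ℝ × (Fin 2 → ℝ)) : Set (ℝ × ℝ) :=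
  {z | ∃ μ₀ ∈ Set.Icc 0 ρ.1, ∃ P ∈ peakPrivate K,
    (∀ᶠ F : ℕ in atTop, ((proposedMR ⌊F * μ₀⌋₊ P).cacheLoad ρ F : ℝ) ≤ z.2 * F) ∧
    LimsupLE (fun F => (proposedMR ⌊F * μ₀⌋₊ P).peakRate ρ F) z.1}

/-- Average rate-memory pairs `(R, M)` achieved by the proposed MR scheme when the Gray-Wyner
network operates at `ρ`. -/
def proposedAvgAchievable (K : ℕ) (ρ : ℝ × (Fin 2 → ℝ)) : Set (ℝ × ℝ) :=
  {z | ∃ μ₀ ∈ Set.Icc 0 ρ.1, ∃ P ∈ avgPrivate K,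
    (∀ᶠ F : ℕ in atTop, ((proposedMR ⌊F * μ₀⌋₊ P).cacheLoad ρ F : ℝ) ≤ z.2 * F) ∧
    LimsupLE (fun F => (proposedMR ⌊F * μ₀⌋₊ P).avgRate ρ F) z.1}

section GWMR

variable {X : Fin 2 → Type*} [∀ i, Fintype (X i)]

/-- Peak rate of the proposed GW-MR scheme: the proposed MR scheme at the best operating point of
the Gray-Wyner network. -/
noncomputable def gwmrPeak (p : (∀ i, X i) → ℝ) (K : ℕ) (M : ℝ) : ℝ :=
  sInf ((fun ρ => rateMemoryFunction (proposedPeakAchievable K ρ) M) '' gwRegion p)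

/-- Average rate of the proposed GW-MR scheme. -/
noncomputable def gwmrAvg (p : (∀ i, X i) → ℝ) (K : ℕ) (M : ℝ) : ℝ :=
  sInf ((fun ρ => rateMemoryFunction (proposedAvgAchievable K ρ) M) '' gwRegion p)

end GWMR

end GWCaching

open GWCaching

namespace GWCaching

/-! ### Entropy of functions on a finite probability space -/

section FiniteEntropy

variable {S T U W : Type*} [Fintype S]

/-! Everything is decided at one operating point of the Gray–Wyner network: describe the common part
`V` in `W₀` and each file conditionally on `V` in its private description, so that `ρ = (H(V),
H(X₁|V), H(X₂|V))`. It lies in the region by typical-set indexing (`mem_gwRegion_of_common`). Since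
`V` is a function of either file and the files are conditionally independent given `V`, `H(X₁|V) =
H(X₁|X₂)` and likewise for the other file. Hence the three rates add up to `H = H(X₁,X₂)`, and the
smaller private rate is exactly `Γ`.

Converse. If the library is appended to the codeword whenever an error occurs, decoding becomes
exact, at an entropy cost of `o(F)`. Determinism and submodularity of entropy then give, after
normalization (`CACMScheme.cutBounds`): two caches and one codeword determine both files, so `H ≤ 2M
+ R`; one cache and two codewords determine both files, so `H ≤ M + 2R`; two cache-codeword pairs
that each reveal file `i`, and jointly everything, give `H(Xᵢ) + H ≤ 2M + 2R`. For the average rate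
the demands are combined so that each one occurs equally often: `d` is paired with its complement
for any `K`, and for `K = 2` each of the four demands is used once, giving `H(X₁) + H(X₂) + 2H ≤ 4M
+ 4R` and `H(Xᵢ) + 2H ≤ 3M + 4R`.

Achievability. At `ρ` the scheme meets these lines. For the peak rate, coded placement gives `R = H
- 2M` up to `M = Γ/K`, and the all-but-one scheme shared with full caching gives `R = (H - M)/2`
from `M = H - 2Γ/K` on; the latter also works for the average rate. For `K = 2` the gap is closed by
segments of slope `-1` for the peak rate, and `-1` and then `-3/4` for the average rate; they match
the remaining inequalities because `H(Xᵢ) = H - Γ` for some `i` and `H(X₁) + H(X₂) = H + H(V)`.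

Conversely, no operating point can do better than the optimum, because a Gray–Wyner code followed by
the multiple-request scheme is itself a cache-aided scheme, up to an arbitrarily small extra rate
(`exists_cacm_family`). So a number that bounds every achievable rate from below and is attained at
`ρ` equals both functions (`sInf_rateMemoryFunction_eq`). -/

theorem nonempty_of_mem_stdSimplex {S : Type*} [Fintype S] {p : S → ℝ} (hp : p ∈ stdSimplex ℝ S) :
    Nonempty S := by
  by_contra h
  rw [not_nonempty_iff] at h
  simpa using hp.2

/-- Probability of `f = t`, without decidability assumptions. -/
noncomputable def pmass (p : S → ℝ) (f : S → T) (t : T) : ℝ :=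
  ∑ s, {s | f s = t}.indicator p s

/-- Entropy (in bits) of a function with values in an arbitrary type, as an expected surprisal. -/
noncomputable def ent (p : S → ℝ) (f : S → T) : ℝ :=
  -∑ s, p s * Real.logb 2 (pmass p f (f s))

theorem law_eq_pmass [DecidableEq T] (p : S → ℝ) (f : S → T) (t : T) :
    law p f t = pmass p f t := by
  simp [law, pmass, Finset.sum_filter, Set.indicator_apply]

theorem pmass_nonneg {p : S → ℝ} (hp : ∀ s, 0 ≤ p s) (f : S → T) (t : T) : 0 ≤ pmass p f t :=
  Finset.sum_nonneg fun _ _ => Set.indicator_nonneg (fun s _ => hp s) _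

theorem pmass_mono {p : S → ℝ} (hp : ∀ s, 0 ≤ p s) {f : S → T} {g : S → U} {t : T} {u : U}
    (h : ∀ s, f s = t → g s = u) : pmass p f t ≤ pmass p g u :=
  Finset.sum_le_sum fun s _ => Set.indicator_le_indicator_of_subset (fun _ hx => h _ hx) hp s

theorem pmass_congr {p : S → ℝ} {f : S → T} {g : S → U} {t : T} {u : U}
    (h : ∀ s, f s = t ↔ g s = u) : pmass p f t = pmass p g u := by
  simp [pmass, h]

theorem le_pmass {p : S → ℝ} (hp : ∀ s, 0 ≤ p s) (f : S → T) (s : S) : p s ≤ pmass p f (f s) := by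
  have := Finset.single_le_sum (f := fun s' => {s' | f s' = f s}.indicator p s')
    (fun i _ => Set.indicator_nonneg (fun s _ => hp s) _) (Finset.mem_univ s)
  simpa [pmass] using this

theorem pmass_pos {p : S → ℝ} (hp : ∀ s, 0 ≤ p s) (f : S → T) {s : S} (h : 0 < p s) :
    0 < pmass p f (f s) :=
  h.trans_le (le_pmass hp f s)

theorem sum_fiber (p : S → ℝ) (f : S → T) (φ : T → ℝ) {A : Finset T} (hA : ∀ s, f s ∈ A) :
    ∑ s, p s * φ (f s) = ∑ t ∈ A, pmass p f t * φ t := by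
  classical
  simp only [pmass, Finset.sum_mul]
  rw [Finset.sum_comm]
  refine Finset.sum_congr rfl fun s _ => ?_
  rw [Finset.sum_eq_single (f s)]
  · simp
  · intro t _ ht
    simp [ht.symm]
  · exact fun h => absurd (hA s) h

theorem sum_pmass {p : S → ℝ} (f : S → T) {A : Finset T} (hA : ∀ s, f s ∈ A) :
    ∑ t ∈ A, pmass p f t = ∑ s, p s := by
  simpa using (sum_fiber p f (fun _ => 1) hA).symm

theorem sum_pmass_pair {p : S → ℝ} (f : S → T) (g : S → U) {A : Finset T} (hA : ∀ s, f s ∈ A)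
    (u : U) : ∑ t ∈ A, pmass p (fun s => (f s, g s)) (t, u) = pmass p g u := by
  classical
  simp only [pmass]
  rw [Finset.sum_comm]
  refine Finset.sum_congr rfl fun s _ => ?_
  rw [Finset.sum_eq_single (f s)]
  · simp [Set.indicator_apply]
  · intro t _ ht
    simp [ht.symm]
  · exact fun h => absurd (hA s) h

/-- Gibbs' inequality for a sub-probability `q`. -/
theorem ent_le_of_sum_le_one {p : S → ℝ} (hp : p ∈ stdSimplex ℝ S) (f : S → T) (q : T → ℝ)
    (hq : ∀ t, 0 ≤ q t) (hpos : ∀ s, 0 < p s → 0 < q (f s)) {A : Finset T} (hA : ∀ s, f s ∈ A)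
    (hsum : ∑ t ∈ A, q t ≤ 1) : ent p f ≤ -∑ s, p s * Real.logb 2 (q (f s)) := by
  have h0 := hp.1
  have hl : 0 < Real.log 2 := Real.log_pos one_lt_two
  have key : ∑ s, p s * (Real.log (q (f s)) - Real.log (pmass p f (f s))) ≤ 0 := by
    calc _ ≤ ∑ s, p s * (q (f s) / pmass p f (f s) - 1) := by
            refine Finset.sum_le_sum fun s _ => ?_
            rcases (h0 s).eq_or_lt with h | h
            · simp [← h]
            · have hm := pmass_pos h0 f h
              rw [← Real.log_div (hpos s h).ne' hm.ne']
              exact mul_le_mul_of_nonneg_left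
                (Real.log_le_sub_one_of_pos (div_pos (hpos s h) hm)) h.le
      _ = ∑ s, p s * (q (f s) / pmass p f (f s)) - 1 := by
            simp only [mul_sub, mul_one, Finset.sum_sub_distrib, hp.2]
      _ = ∑ t ∈ A, pmass p f t * (q t / pmass p f t) - 1 := by
            rw [sum_fiber p f (fun t => q t / pmass p f t) hA]
      _ ≤ ∑ t ∈ A, q t - 1 := by
            gcongr with t
            rcases eq_or_ne (pmass p f t) 0 with h | h
            · simp [h, hq]
            · rw [mul_div_cancel₀ _ h]
      _ ≤ 0 := by linarith
  have e : ∀ s, p s * (Real.log (q (f s)) - Real.log (pmass p f (f s))) / Real.log 2 =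
      p s * Real.logb 2 (q (f s)) - p s * Real.logb 2 (pmass p f (f s)) := by
    intro s; simp only [Real.logb]; ring
  have := div_nonpos_of_nonpos_of_nonneg key hl.le
  rw [Finset.sum_div, Finset.sum_congr rfl fun s _ => e s, Finset.sum_sub_distrib] at this
  unfold ent
  linarith

/-- Level sets of `g` lie inside level sets of `f`, so the surprisal of `g` dominates that of `f`
pointwise. "`g` determines `f`" is stated through equality of values, the form in which decodability
is available later. -/
theorem ent_mono {p : S → ℝ} (hp : ∀ s, 0 ≤ p s) {f : S → T} {g : S → U}
    (h : ∀ s s', g s = g s' → f s = f s') : ent p f ≤ ent p g := by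
  unfold ent
  refine neg_le_neg (Finset.sum_le_sum fun s _ => ?_)
  rcases (hp s).eq_or_lt with h' | h'
  · simp [← h']
  · exact mul_le_mul_of_nonneg_left (Real.logb_le_logb_of_le one_lt_two (pmass_pos hp g h')
      (pmass_mono hp fun s' hs' => h _ _ hs')) h'.le

theorem ent_congr {p : S → ℝ} {f : S → T} {g : S → U}
    (h : ∀ s s', f s = f s' ↔ g s = g s') : ent p f = ent p g := by
  unfold ent
  simp only [pmass_congr (p := p) (fun s' => h s' _)]

/-- Submodularity of entropy. -/
theorem ent_submodular {p : S → ℝ} (hp : p ∈ stdSimplex ℝ S) (f : S → T) (g : S → U) (h : S → W) :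
    ent p (fun s => (f s, g s, h s)) + ent p h ≤
      ent p (fun s => (f s, h s)) + ent p (fun s => (g s, h s)) := by
  classical
  have h0 := hp.1
  -- The competing law in Gibbs' inequality makes `f` and `g` conditionally independent given `h`,
  -- with the correct pair laws.
  set q : T × U × W → ℝ := fun z => pmass p (fun s => (f s, h s)) (z.1, z.2.2) *
    pmass p (fun s => (g s, h s)) (z.2.1, z.2.2) / pmass p h z.2.2 with hqdef
  have hA : ∀ s, (f s, g s, h s) ∈ (Finset.univ.image f) ×ˢ (Finset.univ.image g) ×ˢ
      (Finset.univ.image h) := by intro s; simp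
  have hf : ∀ s, f s ∈ Finset.univ.image f := by simp
  have hg : ∀ s, g s ∈ Finset.univ.image g := by simp
  have hh : ∀ s, h s ∈ Finset.univ.image h := by simp
  have := ent_le_of_sum_le_one hp (fun s => (f s, g s, h s)) q
    (fun t => div_nonneg (mul_nonneg (pmass_nonneg h0 _ _) (pmass_nonneg h0 _ _))
      (pmass_nonneg h0 _ _))
    (fun s hs => div_pos (mul_pos (pmass_pos h0 (fun s => (f s, h s)) hs)
      (pmass_pos h0 (fun s => (g s, h s)) hs)) (pmass_pos h0 h hs)) hA (by
      simp only [Finset.sum_product, hqdef]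
      have : ∀ x ∈ Finset.univ.image f, ∑ y ∈ Finset.univ.image g, ∑ z ∈ Finset.univ.image h,
          pmass p (fun s => (f s, h s)) (x, z) * pmass p (fun s => (g s, h s)) (y, z) /
            pmass p h z = ∑ z ∈ Finset.univ.image h,
          pmass p (fun s => (f s, h s)) (x, z) * pmass p h z / pmass p h z := by
        intro x _
        rw [Finset.sum_comm]
        refine Finset.sum_congr rfl fun z _ => ?_
        rw [← Finset.sum_div, ← Finset.mul_sum, sum_pmass_pair g h hg]
      rw [Finset.sum_congr rfl this, Finset.sum_comm, ← hp.2, ← sum_pmass h hh]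
      refine Finset.sum_le_sum fun z _ => ?_
      rw [← Finset.sum_div, ← Finset.sum_mul, sum_pmass_pair f h hf, mul_self_div_self])
  refine le_sub_iff_add_le.1 (this.trans (le_of_eq ?_))
  unfold ent
  rw [← neg_add, neg_sub_neg, ← Finset.sum_add_distrib, ← Finset.sum_sub_distrib,
    ← Finset.sum_neg_distrib]
  refine Finset.sum_congr rfl fun s _ => ?_
  rcases (h0 s).eq_or_lt with h' | h'
  · simp [← h']
  · have h1 := (pmass_pos h0 (fun s => (f s, h s)) h').ne'
    have h2 := (pmass_pos h0 (fun s => (g s, h s)) h').ne'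
    have h3 := (pmass_pos h0 h h').ne'
    simp only [hqdef]
    rw [Real.logb_div (mul_ne_zero h1 h2) h3, Real.logb_mul h1 h2]
    ring

theorem ent_const {p : S → ℝ} (hp : p ∈ stdSimplex ℝ S) (c : T) : ent p (fun _ => c) = 0 := by
  simp [ent, pmass, hp.2]

theorem ent_pair_le {p : S → ℝ} (hp : p ∈ stdSimplex ℝ S) (f : S → T) (g : S → U) :
    ent p (fun s => (f s, g s)) ≤ ent p f + ent p g := by
  have h := ent_submodular hp f g (fun _ => ())
  rw [ent_const hp, add_zero] at h
  have e1 : ent p (fun s => (f s, g s, ())) = ent p (fun s => (f s, g s)) :=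
    ent_congr (by simp)
  have e2 : ent p (fun s => (f s, ())) = ent p f := ent_congr (by simp)
  have e3 : ent p (fun s => (g s, ())) = ent p g := ent_congr (by simp)
  rwa [e1, e2, e3] at h

/-- If both `f` and `g` determine `h`, then `H(h) + H(f, g) ≤ H(f) + H(g)`. -/
theorem ent_submodular' {p : S → ℝ} (hp : p ∈ stdSimplex ℝ S) {f : S → T} {g : S → U} {h : S → W}
    (hf : ∀ s s', f s = f s' → h s = h s') (hg : ∀ s s', g s = g s' → h s = h s') :
    ent p (fun s => (f s, g s)) + ent p h ≤ ent p f + ent p g := by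
  have := ent_submodular hp f g h
  have e1 : ent p (fun s => (f s, g s, h s)) = ent p (fun s => (f s, g s)) :=
    ent_congr fun s s' => by
      simp only [Prod.mk.injEq]
      exact ⟨fun h => ⟨h.1, h.2.1⟩, fun h => ⟨h.1, h.2, hf _ _ h.1⟩⟩
  have e2 : ent p (fun s => (f s, h s)) = ent p f := ent_congr fun s s' => by
      simp only [Prod.mk.injEq]
      exact ⟨fun h => h.1, fun h => ⟨h, hf _ _ h⟩⟩
  have e3 : ent p (fun s => (g s, h s)) = ent p g := ent_congr fun s s' => by
      simp only [Prod.mk.injEq]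
      exact ⟨fun h => h.1, fun h => ⟨h, hg _ _ h⟩⟩
  rwa [e1, e2, e3] at this

/-- Gibbs' inequality against the uniform law. -/
theorem ent_fin_le {p : S → ℝ} (hp : p ∈ stdSimplex ℝ S) {N : ℕ} (f : S → Fin N) :
    ent p f ≤ Real.logb 2 N := by
  have hS := nonempty_of_mem_stdSimplex hp
  have hN : 0 < N := (Fin.pos_iff_nonempty.2 ⟨f hS.some⟩)
  have := ent_le_of_sum_le_one hp f (fun _ => 1 / (N : ℝ)) (fun _ => by positivity)
    (fun _ _ => by positivity) (A := Finset.univ) (by simp) (by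
      simp [hN.ne'])
  refine this.trans (le_of_eq ?_)
  rw [← Finset.sum_mul, hp.2]
  simp [Real.logb_inv]

/-- There are `2 ^ m` strings of length `m`, so the sum is dominated by a geometric series of ratio
`r`. This replaces Kraft's inequality, which is unavailable because codewords need not be
prefix-free. -/
theorem sum_bitstrings_le (r : ℝ) (hr : 0 < r) (hr1 : r < 1) (A : Finset (List Bool)) :
    ∑ y ∈ A, (1 - r) * (r / 2) ^ y.length ≤ 1 := by
  obtain ⟨n, hn⟩ : ∃ n, ∀ y ∈ A, y.length < n :=
    ⟨A.sup List.length + 1, fun y hy => Nat.lt_succ_of_le (Finset.le_sup (f := List.length) hy)⟩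
  have hcard : ∀ m, (({y ∈ A | y.length = m}).card : ℝ) ≤ 2 ^ m := by
    intro m
    have : ({y ∈ A | y.length = m}).card ≤ (Finset.univ : Finset (List.Vector Bool m)).card := by
      refine Finset.card_le_card_of_surjOn (fun v => v.1) ?_
      intro y hy
      exact ⟨⟨y, (by simpa using hy : y ∈ A ∧ y.length = m).2⟩, Finset.mem_coe.2 (Finset.mem_univ _), rfl⟩
    rw [Finset.card_univ, card_vector, Fintype.card_bool] at this
    exact_mod_cast this
  rw [← Finset.sum_fiberwise_of_maps_to (g := List.length) (t := Finset.range n)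
    (fun y hy => Finset.mem_range.2 (hn y hy))]
  calc _ ≤ ∑ m ∈ Finset.range n, (1 - r) * r ^ m := by
        refine Finset.sum_le_sum fun m _ => ?_
        rw [Finset.sum_congr rfl fun y hy => by rw [(Finset.mem_filter.1 hy).2]]
        rw [Finset.sum_const, nsmul_eq_mul]
        calc _ ≤ (2 : ℝ) ^ m * ((1 - r) * (r / 2) ^ m) := by
              have : 0 ≤ (1 - r) * (r / 2) ^ m := mul_nonneg (by linarith) (by positivity)
              exact mul_le_mul_of_nonneg_right (hcard m) this
          _ = _ := by rw [div_pow]; field_simp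
    _ = 1 - r ^ n := by
        rw [← Finset.mul_sum, mul_comm, geom_sum_mul_neg]
    _ ≤ 1 := by have := pow_pos hr n; linarith

/-- The entropy of a variable-length binary codeword, in terms of its expected length. -/
theorem ent_bitstring_le {δ : ℝ} (hδ : 0 < δ) : ∃ C : ℝ, ∀ {S : Type _} [Fintype S] {p : S → ℝ},
    p ∈ stdSimplex ℝ S → ∀ f : S → List Bool,
    ent p f ≤ (1 + δ) * ∑ s, p s * ((f s).length : ℝ) + C := by
  classical
  -- Chosen so that each bit of a string has surprisal `-log₂ (r / 2) = 1 + δ`; the normalization `1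
  -- - r` costs a constant that does not depend on the block length.
  set r : ℝ := 2 ^ (-δ)
  have hr : 0 < r := by positivity
  have hr1 : r < 1 := Real.rpow_lt_one_of_one_lt_of_neg one_lt_two (by linarith)
  refine ⟨-Real.logb 2 (1 - r), fun {S} _ {p} hp f => ?_⟩
  have h1r : 0 < 1 - r := by linarith
  have := ent_le_of_sum_le_one hp f (fun y => (1 - r) * (r / 2) ^ y.length)
    (fun y => by positivity) (fun s _ => by positivity) (A := Finset.univ.image f) (by simp)
    (sum_bitstrings_le r hr hr1 _)
  refine this.trans (le_of_eq ?_)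
  have e : ∀ s, p s * Real.logb 2 ((1 - r) * (r / 2) ^ (f s).length) =
      p s * Real.logb 2 (1 - r) - (1 + δ) * (p s * (f s).length) := by
    intro s
    rw [Real.logb_mul h1r.ne' (by positivity), Real.logb_pow, Real.logb_div hr.ne' two_ne_zero,
      Real.logb_rpow two_pos (by norm_num), Real.logb_self_eq_one one_lt_two]
    ring
  rw [Finset.sum_congr rfl fun s _ => e s, Finset.sum_sub_distrib, ← Finset.sum_mul, hp.2,
    ← Finset.mul_sum]
  ring

open Classical in
/-- The entropy of a random variable that is revealed only if `E` occurs. -/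
theorem ent_option_le [Fintype T] {p : S → ℝ} (hp : p ∈ stdSimplex ℝ S) (f : S → T)
    (E : S → Prop) : ent p (fun s => if E s then some (f s) else none) ≤
      1 + (∑ s, p s * if E s then 1 else 0) * Real.logb 2 (Fintype.card T) := by
  have hS := nonempty_of_mem_stdSimplex hp
  have hN : 0 < Fintype.card T := Fintype.card_pos_iff.2 ⟨f hS.some⟩
  set N : ℝ := (Fintype.card T : ℝ) with hNdef
  have hN' : 0 < N := Nat.cast_pos.2 hN
  -- Half of the competing mass sits on `none`, and half is spread evenly over the values: one bit
  -- always, and `log₂ N` more only when `E` occurs. This plays the role of Fano's inequality.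
  have := ent_le_of_sum_le_one hp (fun s => if E s then some (f s) else none)
    (fun o => o.elim (1 / 2) fun _ => 1 / (2 * N)) (by rintro (_ | _) <;> simp; positivity)
    (fun s _ => by split_ifs <;> simp; positivity) (A := Finset.univ) (by simp) (by
      rw [Fintype.sum_option]
      simp only [Option.elim_none, Option.elim_some, Finset.sum_const, Finset.card_univ,
        nsmul_eq_mul]
      change 1 / 2 + N * (1 / (2 * N)) ≤ 1
      field_simp; norm_num)
  refine this.trans (le_of_eq ?_)
  have e : ∀ s, p s * Real.logb 2 ((if E s then some (f s) else none : Option T).elim (1 / 2)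
      fun _ => 1 / (2 * N)) = -p s - (p s * if E s then 1 else 0) * Real.logb 2 N := by
    intro s
    split_ifs
    · simp only [Option.elim_some]
      rw [one_div, Real.logb_inv, Real.logb_mul two_ne_zero hN'.ne',
        Real.logb_self_eq_one one_lt_two]
      ring
    · simp [Real.logb_inv, Real.logb_self_eq_one]
  rw [Finset.sum_congr rfl fun s _ => e s, Finset.sum_sub_distrib, Finset.sum_neg_distrib, hp.2,
    ← Finset.sum_mul]
  ring

theorem entropy_eq_ent [Fintype T] [DecidableEq T] (p : S → ℝ) (f : S → T) :
    entropy p f = ent p f := by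
  unfold entropy ent
  rw [sum_fiber p f (fun t => Real.logb 2 (pmass p f t)) (A := Finset.univ) (by simp),
    ← Finset.sum_neg_distrib]
  refine Finset.sum_congr rfl fun t _ => ?_
  rw [law_eq_pmass, Real.negMulLog, Real.logb]
  ring

theorem condEntropy_eq_ent [Fintype T] [Fintype U] [DecidableEq T] [DecidableEq U] {p : S → ℝ}
    (hp : p ∈ stdSimplex ℝ S) (f : S → T) (g : S → U) :
    condEntropy p f g = ent p (fun s => (f s, g s)) - ent p g := by
  have h0 := hp.1
  unfold condEntropy ent
  rw [← Fintype.sum_prod_type', neg_sub_neg, ← Finset.sum_sub_distrib, ← Finset.sum_neg_distrib]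
  have := sum_fiber p (fun s => (f s, g s)) (fun z => -Real.logb 2
    (pmass p (fun s => (f s, g s)) z / pmass p g z.2)) (A := Finset.univ) (by simp)
  simp only [law_eq_pmass]
  simp only [mul_neg] at this
  rw [← this]
  refine Finset.sum_congr rfl fun s _ => ?_
  rcases (h0 s).eq_or_lt with h' | h'
  · simp [← h']
  · rw [Real.logb_div (pmass_pos h0 (fun s => (f s, g s)) h').ne' (pmass_pos h0 g h').ne']
    ring

end FiniteEntropy

/-! ### Memoryless blocks -/

section Blocks

variable {Y Z : Type*} [Fintype Y]

/-- The product pmf on blocks of length `F`. -/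
def blockPmf (p : Y → ℝ) (F : ℕ) (x : Fin F → Y) : ℝ := ∏ t, p (x t)

theorem sum_prod_block {F : ℕ} (h : Fin F → Y → ℝ) :
    ∑ x : Fin F → Y, ∏ t, h t (x t) = ∏ t, ∑ y, h t y := by
  classical
  rw [Finset.prod_univ_sum, Fintype.piFinset_univ]

theorem blockPmf_mem {p : Y → ℝ} (hp : p ∈ stdSimplex ℝ Y) (F : ℕ) :
    blockPmf p F ∈ stdSimplex ℝ (Fin F → Y) := by
  refine ⟨fun x => Finset.prod_nonneg fun t _ => hp.1 _, ?_⟩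
  unfold blockPmf
  rw [sum_prod_block (fun _ y => p y)]
  simp [hp.2]

theorem sum_blockPmf_coord {p : Y → ℝ} (hp : p ∈ stdSimplex ℝ Y) {F : ℕ} (s : Fin F) (g : Y → ℝ) :
    ∑ x, blockPmf p F x * g (x s) = ∑ y, p y * g y := by
  classical
  have : ∀ x : Fin F → Y, blockPmf p F x * g (x s) =
      ∏ t, (p (x t) * if t = s then g (x t) else 1) := by
    intro x
    rw [Finset.prod_mul_distrib, Finset.prod_ite_eq' Finset.univ s, if_pos (Finset.mem_univ _)]
    rfl
  rw [Finset.sum_congr rfl fun x _ => this x,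
    sum_prod_block (fun t y => p y * if t = s then g y else 1),
    Finset.prod_eq_single s]
  · simp
  · intro t _ ht
    simp [ht, hp.2]
  · simp

theorem sum_blockPmf_sum {p : Y → ℝ} (hp : p ∈ stdSimplex ℝ Y) (F : ℕ) (g : Y → ℝ) :
    ∑ x, blockPmf p F x * ∑ t, g (x t) = F * ∑ y, p y * g y := by
  rw [Finset.sum_congr rfl fun x _ => Finset.mul_sum Finset.univ (fun t => g (x t)) _,
    Finset.sum_comm, Finset.sum_congr rfl fun t _ => sum_blockPmf_coord hp t g]
  simp

theorem pmass_blockPmf (p : Y → ℝ) (φ : Y → Z) {F : ℕ} (z : Fin F → Z) :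
    pmass (blockPmf p F) (fun x t => φ (x t)) z = ∏ t, pmass p φ (z t) := by
  classical
  unfold pmass
  rw [← sum_prod_block (fun t y => {y | φ y = z t}.indicator p y)]
  refine Finset.sum_congr rfl fun x _ => ?_
  by_cases h : ∀ t, φ (x t) = z t
  · simp [h, blockPmf]
  · have h' : ¬(fun t => φ (x t)) = z := fun e => h (congrFun e)
    push Not at h
    obtain ⟨t, ht⟩ := h
    rw [Finset.prod_eq_zero (Finset.mem_univ t) (by simp [ht])]
    simp [h']

/-- The mass of a block factors over its coordinates, so its surprisal is a sum of identically
distributed terms. Blocks of probability zero are treated apart, since the logarithm of their mass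
need not split. -/
theorem ent_blockPmf {p : Y → ℝ} (hp : p ∈ stdSimplex ℝ Y) (φ : Y → Z) (F : ℕ) :
    ent (blockPmf p F) (fun x t => φ (x t)) = F * ent p φ := by
  unfold ent
  rw [mul_neg, ← sum_blockPmf_sum hp]
  congr 1
  refine Finset.sum_congr rfl fun x _ => ?_
  rw [pmass_blockPmf]
  by_cases h : ∀ t, p (x t) ≠ 0
  · rw [Real.logb_prod _ _ fun t _ => (pmass_pos hp.1 φ ((hp.1 _).lt_of_ne' (h t))).ne']
  · push Not at h
    obtain ⟨t, ht⟩ := h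
    rw [blockPmf, Finset.prod_eq_zero (Finset.mem_univ t) ht, zero_mul, zero_mul]

open Classical in
/-- One-sided weak law of large numbers, with exponential rate. -/
theorem exists_chernoff {p : Y → ℝ} (hp : p ∈ stdSimplex ℝ Y) (g : Y → ℝ) {ε : ℝ} (hε : 0 < ε) :
    ∃ r : ℝ, 0 ≤ r ∧ r < 1 ∧ ∀ F : ℕ, ∑ x, blockPmf p F x *
      (if F * (∑ y, p y * g y + ε) < ∑ t, g (x t) then 1 else 0) ≤ r ^ F := by
  set μ := ∑ y, p y * g y with hμ
  obtain ⟨C, hC⟩ : ∃ C, ∀ y, |g y - μ - ε| ≤ C :=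
    ⟨_, fun y => Finset.single_le_sum (f := fun y => |g y - μ - ε|) (fun _ _ => abs_nonneg _)
      (Finset.mem_univ y)⟩
  set D := |C| + ε + 1 with hD
  have hD0 : 0 < D := by positivity
  have hDε : ε ≤ D := by have := abs_nonneg C; linarith
  set s := ε / (2 * D ^ 2) with hs
  have hs0 : 0 < s := by positivity
  have hb : ∀ y, |s * (g y - μ - ε)| ≤ s * D := by
    intro y
    rw [abs_mul, abs_of_pos hs0]
    have := (hC y).trans (le_abs_self C)
    exact mul_le_mul_of_nonneg_left (by linarith) hs0.le
  have hsD : s * D ≤ 1 := by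
    rw [hs, div_mul_eq_mul_div, div_le_one (by positivity)]
    nlinarith
  refine ⟨∑ y, p y * Real.exp (s * (g y - μ - ε)),
    Finset.sum_nonneg fun y _ => mul_nonneg (hp.1 y) (Real.exp_pos _).le, ?_, fun F => ?_⟩
  · calc _ ≤ ∑ y, p y * (1 + s * (g y - μ - ε) + (s * D) ^ 2) := by
          refine Finset.sum_le_sum fun y _ => mul_le_mul_of_nonneg_left ?_ (hp.1 y)
          have h1 := Real.abs_exp_sub_one_sub_id_le ((hb y).trans hsD)
          have h2 := (abs_le.1 h1).2
          have h3 : (s * (g y - μ - ε)) ^ 2 ≤ (s * D) ^ 2 := sq_le_sq' (abs_le.1 (hb y)).1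
            (abs_le.1 (hb y)).2
          linarith
      _ = 1 - s * ε + (s * D) ^ 2 := by
          have : ∀ y, p y * (1 + s * (g y - μ - ε) + (s * D) ^ 2) =
              p y * (1 - s * μ - s * ε + (s * D) ^ 2) + s * (p y * g y) := fun y => by ring
          rw [Finset.sum_congr rfl fun y _ => this y, Finset.sum_add_distrib, ← Finset.sum_mul,
            ← Finset.mul_sum, hp.2, ← hμ]
          ring
      _ < 1 := by
          have : (s * D) ^ 2 = s * ε / 2 := by
            rw [hs]; field_simp
          have := mul_pos hs0 hε
          linarith
  -- Markov's inequality for the exponential: the indicator is at most the product of the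
  -- exponentials, whose expectation is `r ^ F` by independence.
  · rw [← Fin.prod_const, ← sum_prod_block (fun _ y => p y * Real.exp (s * (g y - μ - ε)))]
    refine Finset.sum_le_sum fun x _ => ?_
    rw [Finset.prod_mul_distrib, ← Real.exp_sum]
    refine mul_le_mul_of_nonneg_left ?_ ((blockPmf_mem hp F).1 x)
    split_ifs with h
    · refine Real.one_le_exp ?_
      rw [← Finset.mul_sum]
      refine mul_nonneg hs0.le ?_
      simp only [Finset.sum_sub_distrib, Finset.sum_const, Finset.card_univ, Fintype.card_fin,
        nsmul_eq_mul]
      linarith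
    · exact (Real.exp_pos _).le

end Blocks

/-! ### Converse bounds -/

section Converse

variable {X : Fin 2 → Type*} [∀ i, Fintype (X i)] {K F : ℕ} {M : ℝ}

theorem prob_mono {p : (∀ i, X i) → ℝ} (hp : p ∈ stdSimplex ℝ (∀ i, X i)) {E E' : Block X F → Prop}
    (h : ∀ x, 0 < blockPmf p F x → E x → E' x) : prob p E ≤ prob p E' := by
  classical
  refine Finset.sum_le_sum fun x _ => ?_
  have h0 : 0 ≤ blockPmf p F x := (blockPmf_mem hp F).1 x
  rcases h0.eq_or_lt with h1 | h1
  · have h1' : ∏ t, p (x t) = 0 := h1.symm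
    simp [h1']
  · refine mul_le_mul_of_nonneg_left ?_ h0
    by_cases hE : E x
    · simp [hE, h x h1 hE]
    · simp only [hE, if_false]; split_ifs <;> norm_num

theorem prob_nonneg {p : (∀ i, X i) → ℝ} (hp : p ∈ stdSimplex ℝ (∀ i, X i)) (E : Block X F → Prop) :
    0 ≤ prob p E :=
  Finset.sum_nonneg fun x _ => mul_nonneg ((blockPmf_mem hp F).1 x)
    (by dsimp only; split_ifs <;> norm_num)

namespace CACMScheme

/-- Some receiver errs under the demand `d`. -/
def Errs (S : CACMScheme X K F M) (d : Demand K) (x : Block X F) : Prop :=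
  ∃ k, S.decode k d (S.codeword d x) (S.cache k x) ≠ file x (d k)

open Classical in
/-- The codeword, supplemented by the library in case of an error. -/
noncomputable def transcript (S : CACMScheme X K F M) (d : Demand K) (x : Block X F) :
    List Bool × Option (Block X F) :=
  (S.codeword d x, if S.Errs d x then some x else none)

omit [∀ i, Fintype (X i)] in
-- Revealing the whole library on an error turns almost lossless decoding into an exact functional
-- dependence, so the converse can use plain monotonicity of entropy.
theorem file_eq_of_transcript_eq (S : CACMScheme X K F M) {d : Demand K} {k : Fin K}
    {x x' : Block X F} (hc : S.cache k x = S.cache k x')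
    (ht : S.transcript d x = S.transcript d x') : file x (d k) = file x' (d k) := by
  simp only [transcript, Prod.mk.injEq] at ht
  obtain ⟨h1, h2⟩ := ht
  by_cases hx : S.Errs d x <;> by_cases hx' : S.Errs d x'
  · simp only [hx, hx', if_true, Option.some.injEq] at h2
    rw [h2]
  · simp [hx, hx'] at h2
  · simp [hx, hx'] at h2
  · simp only [Errs, not_exists, not_not] at hx hx'
    rw [← hx k, ← hx' k, h1, hc]

variable {p : (∀ i, X i) → ℝ}

theorem prob_errs_le (S : CACMScheme X K F M) (p : (∀ i, X i) → ℝ) (d : Demand K) :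
    prob p (S.Errs d) ≤ S.errorProb p :=
  le_ciSup (f := fun d : Demand K => prob p (S.Errs d)) (Set.finite_range _).bddAbove d

theorem ent_cache_le (S : CACMScheme X K F M) (hp : p ∈ stdSimplex ℝ (∀ i, X i)) (k : Fin K) :
    ent (blockPmf p F) (S.cache k) ≤ M * F := by
  have hP := blockPmf_mem hp F
  have hS := nonempty_of_mem_stdSimplex hP
  have hN : 0 < S.cacheSize := Fin.pos_iff_nonempty.2 ⟨S.cache k hS.some⟩
  refine (ent_fin_le hP _).trans ?_
  rw [Real.logb_le_iff_le_rpow one_lt_two (by exact_mod_cast hN)]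
  exact S.cacheSize_le

theorem ent_transcript_le {δ : ℝ} (hδ : 0 < δ) (hp : p ∈ stdSimplex ℝ (∀ i, X i)) :
    ∃ C : ℝ, ∀ {K F : ℕ} {M : ℝ} (S : CACMScheme X K F M) (d : Demand K),
      ent (blockPmf p F) (S.transcript d) ≤ (1 + δ) * S.expectedLength p d + C +
        S.errorProb p * (F * Real.logb 2 (Fintype.card (∀ i, X i))) := by
  classical
  obtain ⟨C, hC⟩ := ent_bitstring_le hδ
  refine ⟨C + 1, fun {K F M} S d => ?_⟩
  have hP := blockPmf_mem hp F
  have h1 := hC hP (S.codeword d)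
  have h2 := ent_option_le hP id (S.Errs d)
  have h3 := ent_pair_le hP (S.codeword d) (fun x => if S.Errs d x then some (id x) else none)
  have h4 : ent (blockPmf p F) (S.transcript d) = ent (blockPmf p F)
      (fun x => (S.codeword d x, if S.Errs d x then some (id x) else none)) := by
    refine ent_congr fun s s' => ?_
    simp only [transcript, id]
  have h5 : ∑ x, blockPmf p F x * (if S.Errs d x then (1 : ℝ) else 0) ≤ S.errorProb p := by
    refine le_trans (le_of_eq ?_) (S.prob_errs_le p d)
    unfold prob expect blockPmf
    refine Finset.sum_congr rfl fun x _ => ?_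
    congr
  have hcard : Real.logb 2 (Fintype.card (Fin F → ∀ i, X i)) =
      F * Real.logb 2 (Fintype.card (∀ i, X i)) := by
    rw [Fintype.card_fun, Fintype.card_fin, Nat.cast_pow, Real.logb_pow]
  have h6 : 0 ≤ F * Real.logb 2 (Fintype.card (∀ i, X i)) := by
    rw [← hcard]
    rcases Nat.eq_zero_or_pos (Fintype.card (Fin F → ∀ i, X i)) with h | h
    · simp [h]
    · exact Real.logb_nonneg one_lt_two (by exact_mod_cast h)
  have h7 := mul_le_mul_of_nonneg_right h5 h6
  rw [hcard] at h2
  have h8 : ∑ x, blockPmf p F x * ((S.codeword d x).length : ℝ) = S.expectedLength p d := rfl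
  rw [h8] at h1
  rw [h4]
  linarith

end CACMScheme

/-- Cut-set and submodularity bounds, in terms of upper bounds `u` on the entropy rates of the
codewords. -/
structure CutBounds (p : (∀ i, X i) → ℝ) (K : ℕ) (M : ℝ) (u : Demand K → ℝ) : Prop where
  two_caches : ∀ d k k', d k ≠ d k' → ent p id ≤ 2 * M + u d
  two_codewords : ∀ d d' k, d k ≠ d' k → ent p id ≤ M + u d + u d'
  two_each : ∀ i d d' k k', d k = i → d' k' = i → (d k' ≠ i ∨ d' k ≠ i) →
    ent p (fun y => y i) + ent p id ≤ 2 * M + u d + u d'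

omit [∀ i, Fintype (X i)] in
theorem block_ext {x x' : Block X F} {i j : Fin 2} (hij : i ≠ j) (hi : file x i = file x' i)
    (hj : file x j = file x' j) : x = x' := by
  funext t l
  have : l = i ∨ l = j := by omega
  rcases this with rfl | rfl
  · exact congrFun hi t
  · exact congrFun hj t

/-- The first two bounds are cut-sets: the listed caches and transcripts determine two different
files, hence the library. For `two_each`, both pairs (cache `k`, transcript `d`) and (cache `k'`,
transcript `d'`) determine file `i`, while a crossed pair, cache `k'` with `d` or cache `k` with
`d'`, yields the other file. Submodularity therefore gains one `H(Xᵢ)`. -/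
theorem CACMScheme.cutBounds {p : (∀ i, X i) → ℝ} (hp : p ∈ stdSimplex ℝ (∀ i, X i)) (hF : 0 < F)
    (S : CACMScheme X K F M) {u : Demand K → ℝ}
    (hu : ∀ d, ent (blockPmf p F) (S.transcript d) ≤ u d * F) : CutBounds p K M u := by
  have hF' : (0 : ℝ) < F := by exact_mod_cast hF
  have hP := blockPmf_mem hp F
  have hfull : ent (blockPmf p F) id = F * ent p id := ent_blockPmf hp id F
  have hfile : ∀ i, ent (blockPmf p F) (fun x => file x i) = F * ent p (fun y => y i) :=
    fun i => ent_blockPmf hp (fun y => y i) F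
  have hZY : ∀ d k, ent (blockPmf p F) (fun x => (S.cache k x, S.transcript d x)) ≤
      (M + u d) * F := fun d k => by
    have := ent_pair_le hP (S.cache k) (S.transcript d)
    have := S.ent_cache_le hp k
    have := hu d
    linarith
  refine ⟨fun d k k' h => ?_, fun d d' k h => ?_, fun i d d' k k' hk hk' h => ?_⟩
  · refine le_of_mul_le_mul_left ?_ hF'
    rw [← hfull]
    have h1 : ent (blockPmf p F) id ≤ ent (blockPmf p F)
        (fun x => ((S.cache k x, S.transcript d x), S.cache k' x)) := by
      refine ent_mono hP.1 fun x x' e => ?_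
      simp only [Prod.mk.injEq] at e
      exact block_ext h (S.file_eq_of_transcript_eq e.1.1 e.1.2)
        (S.file_eq_of_transcript_eq e.2 e.1.2)
    have h2 := ent_pair_le hP (fun x => (S.cache k x, S.transcript d x)) (S.cache k')
    have := S.ent_cache_le hp k'
    have := hZY d k
    linarith
  · refine le_of_mul_le_mul_left ?_ hF'
    rw [← hfull]
    have h1 : ent (blockPmf p F) id ≤ ent (blockPmf p F)
        (fun x => ((S.cache k x, S.transcript d x), S.transcript d' x)) := by
      refine ent_mono hP.1 fun x x' e => ?_
      simp only [Prod.mk.injEq] at e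
      exact block_ext h (S.file_eq_of_transcript_eq e.1.1 e.1.2)
        (S.file_eq_of_transcript_eq e.1.1 e.2)
    have h2 := ent_pair_le hP (fun x => (S.cache k x, S.transcript d x)) (S.transcript d')
    have := hu d'
    have := hZY d k
    linarith
  · refine le_of_mul_le_mul_left ?_ hF'
    rw [mul_add, ← hfull, ← hfile]
    have hi : ∀ x x', (S.cache k x, S.transcript d x) = (S.cache k x', S.transcript d x') →
        file x i = file x' i := fun x x' e => by
      subst hk
      simp only [Prod.mk.injEq] at e
      exact S.file_eq_of_transcript_eq e.1 e.2
    have hi' : ∀ x x', (S.cache k' x, S.transcript d' x) = (S.cache k' x', S.transcript d' x') →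
        file x i = file x' i := fun x x' e => by
      subst hk'
      simp only [Prod.mk.injEq] at e
      exact S.file_eq_of_transcript_eq e.1 e.2
    have h1 := ent_submodular' hP hi hi'
    have h2 : ent (blockPmf p F) id ≤ ent (blockPmf p F) (fun x =>
        ((S.cache k x, S.transcript d x), (S.cache k' x, S.transcript d' x))) := by
      refine ent_mono hP.1 fun x x' e => ?_
      have e' := (Prod.mk.injEq _ _ _ _).mp e
      have hix := hi x x' e'.1
      simp only [Prod.mk.injEq] at e
      rcases h with h | h
      · exact block_ext h (S.file_eq_of_transcript_eq e.2.1 e.1.2) hix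
      · exact block_ext h (S.file_eq_of_transcript_eq e.1.1 e.2.2) hix
    have := hZY d k
    have := hZY d' k'
    linarith

/-- The constant from the codeword lengths and the term (error probability) · `F log₂ |X|` are both
`o(F)`, so together they are eventually absorbed by the additive `δ`. -/
theorem exists_cutBounds {p : (∀ i, X i) → ℝ} (hp : p ∈ stdSimplex ℝ (∀ i, X i))
    {S : ∀ F : ℕ, CACMScheme X K F M} (hS : Tendsto (fun F => (S F).errorProb p) atTop (𝓝 0))
    {δ : ℝ} (hδ : 0 < δ) : ∀ᶠ F : ℕ in atTop,
      CutBounds p K M (fun d => (1 + δ) * ((S F).expectedLength p d / F) + δ) := by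
  obtain ⟨C, hC⟩ := CACMScheme.ent_transcript_le hδ hp
  set B := Real.logb 2 (Fintype.card (∀ i, X i))
  have hlim : Tendsto (fun F : ℕ => C / F + (S F).errorProb p * B) atTop (𝓝 0) := by
    simpa using (tendsto_const_div_atTop_nhds_zero_nat C).add (hS.mul_const B)
  filter_upwards [hlim.eventually_lt_const hδ, eventually_gt_atTop 0] with F hF hF0
  have hF' : (0 : ℝ) < F := by exact_mod_cast hF0
  refine (S F).cutBounds hp hF0 fun d => (hC (S F) d).trans ?_
  have e1 : C = C / F * F := by field_simp
  have e2 : (S F).expectedLength p d = (S F).expectedLength p d / F * F := by field_simp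
  have := mul_le_mul_of_nonneg_right hF.le hF'.le
  rw [e2]
  simp only [mul_div_assoc, div_self hF'.ne', mul_one]
  nlinarith

theorem exists_pos_slack (R : ℝ) {η : ℝ} (hη : 0 < η) :
    ∃ δ > 0, (1 + δ) * (R + δ) + δ ≤ R + η := by
  have hc : ContinuousAt (fun δ : ℝ => (1 + δ) * (R + δ) + δ) 0 := by fun_prop
  have h : ∀ᶠ δ in 𝓝[>] (0 : ℝ), (1 + δ) * (R + δ) + δ < R + η :=
    (hc.tendsto.mono_left nhdsWithin_le_nhds).eventually_lt_const (by simpa using hη)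
  obtain ⟨δ, h1, h2⟩ := (h.and self_mem_nhdsWithin).exists
  exact ⟨δ, h2, h1.le⟩

theorem peakAchievable.exists_cutBounds {p : (∀ i, X i) → ℝ} (hp : p ∈ stdSimplex ℝ (∀ i, X i))
    {z : ℝ × ℝ} (hz : z ∈ peakAchievable p K) {η : ℝ} (hη : 0 < η) :
    ∃ u, CutBounds p K z.2 u ∧ ∀ d, u d ≤ z.1 + η := by
  obtain ⟨S, hS, hR⟩ := hz
  obtain ⟨δ, hδ, hle⟩ := exists_pos_slack z.1 hη
  obtain ⟨F, h1, h2⟩ := ((GWCaching.exists_cutBounds hp hS hδ).and (hR δ hδ)).exists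
  refine ⟨_, h1, fun d => le_trans ?_ hle⟩
  have : (S F).expectedLength p d / F ≤ (S F).peakRate p :=
    le_ciSup (f := fun d => (S F).expectedLength p d / F) (Set.finite_range _).bddAbove d
  have := this.trans h2
  gcongr

theorem avgAchievable.exists_cutBounds {p : (∀ i, X i) → ℝ} (hp : p ∈ stdSimplex ℝ (∀ i, X i))
    {z : ℝ × ℝ} (hz : z ∈ avgAchievable p K) {η : ℝ} (hη : 0 < η) :
    ∃ u : Demand K → ℝ, CutBounds p K z.2 u ∧ ∑ d, u d ≤ 2 ^ K * (z.1 + η) := by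
  obtain ⟨S, hS, hR⟩ := hz
  obtain ⟨δ, hδ, hle⟩ := exists_pos_slack z.1 hη
  obtain ⟨F, h1, h2⟩ := ((GWCaching.exists_cutBounds hp hS hδ).and (hR δ hδ)).exists
  refine ⟨_, h1, ?_⟩
  have e : ∑ d : Demand K, ((1 + δ) * ((S F).expectedLength p d / F) + δ) =
      2 ^ K * ((1 + δ) * (S F).avgRate p + δ) := by
    rw [Finset.sum_add_distrib, ← Finset.mul_sum, ← Finset.sum_div]
    simp only [CACMScheme.avgRate, Finset.sum_const, Finset.card_univ, Fintype.card_fun,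
      Fintype.card_fin, nsmul_eq_mul, Nat.cast_pow, Nat.cast_ofNat]
    field_simp
  rw [e]
  refine mul_le_mul_of_nonneg_left (le_trans ?_ hle) (by positivity)
  gcongr

/-- A closed linear constraint valid with arbitrarily small slack extends to the closure. -/
theorem le_of_mem_closure {𝒜 : Set (ℝ × ℝ)} {a b c : ℝ}
    (h : ∀ z ∈ 𝒜, ∀ η > 0, a ≤ b * z.2 + c * (z.1 + η)) :
    ∀ z ∈ closure 𝒜, a ≤ b * z.2 + c * z.1 := by
  have hcl : IsClosed {z : ℝ × ℝ | a ≤ b * z.2 + c * z.1} :=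
    isClosed_le continuous_const (by fun_prop)
  refine fun z hz => closure_minimal (fun z hz => ?_) hcl hz
  have hc : ContinuousAt (fun η : ℝ => b * z.2 + c * (z.1 + η)) 0 := by fun_prop
  have := hc.tendsto.mono_left (nhdsWithin_le_nhds (s := Set.Ioi 0))
  simp only [add_zero] at this
  exact ge_of_tendsto this (eventually_nhdsWithin_of_forall fun η hη => h z hz η hη)

/-! ### Linear inequalities satisfied by the optimal rate-memory regions -/

variable {p : (∀ i, X i) → ℝ} (hp : p ∈ stdSimplex ℝ (∀ i, X i))
include hp

theorem peak_two_caches (hK : 2 ≤ K) : ∀ z ∈ closure (peakAchievable p K),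
    ent p id ≤ 2 * z.2 + 1 * z.1 := by
  refine le_of_mem_closure fun z hz η hη => ?_
  obtain ⟨u, hu, hle⟩ := peakAchievable.exists_cutBounds hp hz hη
  let d : Demand K := fun k => if k = ⟨0, by omega⟩ then 0 else 1
  have := hu.two_caches d ⟨0, by omega⟩ ⟨1, by omega⟩ (by simp [d])
  have := hle d
  linarith

theorem peak_two_codewords (hK : 2 ≤ K) : ∀ z ∈ closure (peakAchievable p K),
    ent p id ≤ 1 * z.2 + 2 * z.1 := by
  refine le_of_mem_closure fun z hz η hη => ?_
  obtain ⟨u, hu, hle⟩ := peakAchievable.exists_cutBounds hp hz hη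
  have := hu.two_codewords (fun _ => 0) (fun _ => 1) ⟨0, by omega⟩ (by simp)
  have := hle (fun _ => 0)
  have := hle (fun _ => 1)
  linarith

theorem peak_two_each (hK : 2 ≤ K) (i : Fin 2) : ∀ z ∈ closure (peakAchievable p K),
    ent p (fun y => y i) + ent p id ≤ 2 * z.2 + 2 * z.1 := by
  refine le_of_mem_closure fun z hz η hη => ?_
  obtain ⟨u, hu, hle⟩ := peakAchievable.exists_cutBounds hp hz hη
  -- File `i` is requested by receiver 0 alone under `d` and by receiver 1 alone under `d'`, so
  -- receiver 1's cache together with the transcript of `d` reveals the other file.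
  let d : Demand K := fun k => if k = ⟨0, by omega⟩ then i else 1 - i
  let d' : Demand K := fun k => if k = ⟨1, by omega⟩ then i else 1 - i
  have := hu.two_each i d d' ⟨0, by omega⟩ ⟨1, by omega⟩ (by simp [d]) (by simp [d'])
    (Or.inl (by simp only [d]; rw [if_neg (by simp)]; omega))
  have := hle d
  have := hle d'
  linarith

/-- Under a demand and its complement receiver 0 obtains both files. Complementation permutes the
demands, so summing over all of them turns both codeword terms into the average rate. -/
theorem avg_two_codewords (hK : 2 ≤ K) : ∀ z ∈ closure (avgAchievable p K),
    ent p id ≤ 1 * z.2 + 2 * z.1 := by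
  refine le_of_mem_closure fun z hz η hη => ?_
  obtain ⟨u, hu, hle⟩ := avgAchievable.exists_cutBounds hp hz hη
  have h1 : ∑ _d : Demand K, ent p id ≤ ∑ d : Demand K, (z.2 + u d + u (fun k => 1 - d k)) :=
    Finset.sum_le_sum fun d _ => hu.two_codewords d _ ⟨0, by omega⟩ (by omega)
  have h2 : ∑ d : Demand K, u (fun k => 1 - d k) = ∑ d, u d :=
    Fintype.sum_equiv (Equiv.piCongrRight fun _ => Equiv.subLeft 1) _ _ fun d => rfl
  simp only [Finset.sum_add_distrib, h2, Finset.sum_const, Finset.card_univ, Fintype.card_fun,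
    Fintype.card_fin, nsmul_eq_mul, Nat.cast_pow, Nat.cast_ofNat] at h1
  have : (0 : ℝ) < 2 ^ K := by positivity
  refine le_of_mul_le_mul_left ?_ this
  linarith

omit hp in
theorem sum_demand_two (u : Demand 2 → ℝ) :
    ∑ d, u d = u ![0, 0] + u ![0, 1] + u ![1, 0] + u ![1, 1] := by
  rw [← (finTwoArrowEquiv (Fin 2)).symm.sum_comp, Fintype.sum_prod_type]
  simp [Fin.sum_univ_two, finTwoArrowEquiv]
  ring

/-- The demands `00, 10` serve the bound for file 0 and `11, 01` the bound for file 1; each of the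
four occurs once, so the codeword terms add up to four times the average. -/
theorem avg_four_caches : ∀ z ∈ closure (avgAchievable p 2),
    ent p (fun y => y 0) + ent p (fun y => y 1) + 2 * ent p id ≤ 4 * z.2 + 4 * z.1 := by
  refine le_of_mem_closure fun z hz η hη => ?_
  obtain ⟨u, hu, hle⟩ := avgAchievable.exists_cutBounds hp hz hη
  rw [sum_demand_two] at hle
  have := hu.two_each 0 ![0, 0] ![1, 0] 0 1 (by simp) (by simp) (by simp)
  have := hu.two_each 1 ![1, 1] ![0, 1] 0 1 (by simp) (by simp) (by simp)
  linarith

/-- One submodularity bound uses two of the four demands, and a one-cache cut-set bound uses the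
other two. Hence three memory terms and, again, four average rates. -/
theorem avg_three_caches (i : Fin 2) : ∀ z ∈ closure (avgAchievable p 2),
    ent p (fun y => y i) + 2 * ent p id ≤ 3 * z.2 + 4 * z.1 := by
  refine le_of_mem_closure fun z hz η hη => ?_
  obtain ⟨u, hu, hle⟩ := avgAchievable.exists_cutBounds hp hz hη
  rw [sum_demand_two] at hle
  fin_cases i
  · have := hu.two_each 0 ![0, 0] ![1, 0] 0 1 (by simp) (by simp) (by simp)
    have := hu.two_codewords ![0, 1] ![1, 1] 0 (by simp)
    simp only [Fin.zero_eta]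
    linarith
  · have := hu.two_each 1 ![1, 1] ![0, 1] 0 1 (by simp) (by simp) (by simp)
    have := hu.two_codewords ![1, 0] ![0, 0] 0 (by simp)
    simp only [Fin.mk_one]
    linarith

end Converse

/-! ### Achievability in the Gray-Wyner network -/

section Typicality

variable {S Y C : Type*} [Fintype S] [Fintype Y]

theorem card_le_rpow_of_weights {α : Type*} (T : Finset α) (w : α → ℝ) {W c : ℝ} (hW : 0 < W)
    (hsum : ∑ x ∈ T, w x ≤ W) (h : ∀ x ∈ T, W * 2 ^ (-c) ≤ w x) : (T.card : ℝ) ≤ 2 ^ c := by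
  have h1 : T.card * (W * 2 ^ (-c)) ≤ W := by
    rw [← nsmul_eq_mul]
    exact (Finset.card_nsmul_le_sum T w _ h).trans hsum
  rw [Real.rpow_neg two_pos.le] at h1
  have h2 : (0 : ℝ) < 2 ^ c := by positivity
  field_simp at h1
  exact h1

/-- The conditional information density of `f` given its function `κ ∘ f`. -/
noncomputable def infoDensity (p : S → ℝ) (f : S → Y) (κ : Y → C) (y : Y) : ℝ :=
  Real.logb 2 (pmass p (κ ∘ f) (κ y)) - Real.logb 2 (pmass p f y)

omit [Fintype Y] in
theorem sum_infoDensity (p : S → ℝ) (f : S → Y) (κ : Y → C) :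
    ∑ s, p s * infoDensity p f κ (f s) = ent p f - ent p (κ ∘ f) := by
  simp only [infoDensity, ent, mul_sub, Finset.sum_sub_distrib, Function.comp]
  ring

open Classical in
/-- Blocks `y` with `κ y = c` whose conditional information density is at most `L`. -/
noncomputable def typicalSet (p : S → ℝ) (f : S → Y) (κ : Y → C) {F : ℕ} (L : ℝ) (c : Fin F → C) :
    Finset (Fin F → Y) :=
  {y | (∀ t, κ (y t) = c t) ∧ (∀ t, 0 < pmass p f (y t)) ∧ ∑ t, infoDensity p f κ (y t) ≤ L}

/-- Given `c`, each member has conditional probability at least `2 ^ (-L)`, so there are at most `2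
^ L` of them. Positivity of the masses in `typicalSet` makes the logarithms genuine. -/
theorem card_typicalSet_le {p : S → ℝ} (hp : ∀ s, 0 ≤ p s) (f : S → Y) (κ : Y → C) {F : ℕ} (L : ℝ)
    (c : Fin F → C) : ((typicalSet p f κ L c).card : ℝ) ≤ 2 ^ L := by
  classical
  rcases (typicalSet p f κ L c).eq_empty_or_nonempty with h | ⟨y₀, hy₀⟩
  · rw [h]; simp; positivity
  have hle : ∀ y, pmass p f y ≤ pmass p (κ ∘ f) (κ y) := fun y =>
    pmass_mono hp fun s hs => congrArg κ hs
  simp only [typicalSet, Finset.mem_filter, Finset.mem_univ, true_and] at hy₀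
  have hc : ∀ t, 0 < pmass p (κ ∘ f) (c t) := fun t => by
    rw [← hy₀.1 t]; exact (hy₀.2.1 t).trans_le (hle _)
  -- The weights are the product masses restricted to the fibre over `c`; their total is the mass of
  -- `c`.
  refine card_le_rpow_of_weights _ (fun y => ∏ t, {y | κ y = c t}.indicator (pmass p f) (y t))
    (W := ∏ t, pmass p (κ ∘ f) (c t)) (Finset.prod_pos fun t _ => hc t) ?_ ?_
  · refine (Finset.sum_le_univ_sum_of_nonneg fun y => Finset.prod_nonneg fun t _ =>
      Set.indicator_nonneg (fun s _ => pmass_nonneg hp _ _) _).trans (le_of_eq ?_)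
    rw [sum_prod_block (fun t y => {y | κ y = c t}.indicator (pmass p f) y)]
    refine Finset.prod_congr rfl fun t _ => ?_
    have := sum_fiber p f (fun y => {y | κ y = c t}.indicator (fun _ => (1 : ℝ)) y)
      (A := Finset.univ) (by simp)
    simp only [Set.indicator_apply, Set.mem_ofPred_eq, mul_ite, mul_one, mul_zero] at this
    simp only [Set.indicator_apply, Set.mem_ofPred_eq]
    rw [← this]
    simp [pmass, Set.indicator_apply]
  · intro y hy
    simp only [typicalSet, Finset.mem_filter, Finset.mem_univ, true_and] at hy
    obtain ⟨h1, h2, h3⟩ := hy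
    rw [Finset.prod_congr rfl fun t _ => show {y | κ y = c t}.indicator (pmass p f) (y t) =
      pmass p f (y t) by simp [h1]]
    have hP := Finset.prod_pos fun t (_ : t ∈ Finset.univ) => h2 t
    have hC := Finset.prod_pos fun t (_ : t ∈ Finset.univ) => hc t
    rw [Real.rpow_neg two_pos.le, ← div_eq_mul_inv, div_le_iff₀ (by positivity),
      ← div_le_iff₀' hP, ← Real.logb_le_iff_le_rpow one_lt_two (div_pos hC hP),
      Real.logb_div hC.ne' hP.ne', Real.logb_prod _ _ fun t _ => (hc t).ne',
      Real.logb_prod _ _ fun t _ => (h2 t).ne', ← Finset.sum_sub_distrib]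
    refine le_trans (le_of_eq (Finset.sum_congr rfl fun t _ => ?_)) h3
    rw [infoDensity, h1]

theorem exists_injOn_fin {α : Type*} (T : Finset α) {N : ℕ} (hN : 0 < N) (h : T.card ≤ N) :
    ∃ e : α → Fin N, Set.InjOn e T := by
  classical
  refine ⟨fun x => if hx : x ∈ T then Fin.castLE h (T.equivFin ⟨x, hx⟩) else ⟨0, hN⟩, ?_⟩
  intro x hx y hy e
  simp only [Finset.mem_coe] at hx hy
  simp only [hx, hy, dif_pos] at e
  simpa using e

end Typicality

/-! ### Gray–Wyner codes from typical sets -/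

section GWCodes

variable {X : Fin 2 → Type*} [∀ i, Fintype (X i)]

open Classical in
-- The decoder returns the file of any good block that is consistent with the received indices. If
-- the true block is good, `hgood` forces agreement, so errors occur only on bad blocks.
theorem exists_gwCode {p : (∀ i, X i) → ℝ} (hp : p ∈ stdSimplex ℝ (∀ i, X i)) {F : ℕ}
    {ρ : ℝ × (Fin 2 → ℝ)} {N₀ : ℕ} {N : Fin 2 → ℕ} (h₀ : (N₀ : ℝ) ≤ 2 ^ (F * ρ.1))
    (h : ∀ i, (N i : ℝ) ≤ 2 ^ (F * ρ.2 i)) (enc₀ : Block X F → Fin N₀)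
    (enc : ∀ i, Block X F → Fin (N i)) (good : Block X F → Prop)
    (hgood : ∀ x x', good x → good x' → enc₀ x = enc₀ x' → ∀ i, enc i x = enc i x' →
      file x i = file x' i) :
    ∃ C : GWCode X F ρ, C.errorProb p ≤ prob p (fun x => ¬good x) := by
  have hX := nonempty_of_mem_stdSimplex hp
  refine ⟨⟨N₀, N, h₀, h, enc₀, enc, fun i c w => if h : ∃ x, good x ∧ enc₀ x = c ∧ enc i x = w
    then file h.choose i else fun _ => hX.some i⟩, prob_mono hp fun x _ hx hg => ?_⟩
  obtain ⟨i, hi⟩ := hx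
  have hex : ∃ x', good x' ∧ enc₀ x' = enc₀ x ∧ enc i x' = enc i x := ⟨x, hg, rfl, rfl⟩
  simp only [dif_pos hex] at hi
  have hs := hex.choose_spec
  exact hi (hgood _ _ hs.1 hg hs.2.1 i hs.2.2)

theorem prob_or_le {p : (∀ i, X i) → ℝ} (hp : p ∈ stdSimplex ℝ (∀ i, X i)) {F : ℕ}
    (E E' : Block X F → Prop) : prob p (fun x => E x ∨ E' x) ≤ prob p E + prob p E' := by
  classical
  simp only [prob, expect, ← Finset.sum_add_distrib, ← mul_add]
  refine Finset.sum_le_sum fun x _ => mul_le_mul_of_nonneg_left ?_ ((blockPmf_mem hp F).1 x)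
  by_cases h1 : E x <;> by_cases h2 : E' x <;> simp [h1, h2]

theorem tendsto_prob_infoDensity {Y C : Type*} [Fintype Y] {p : (∀ i, X i) → ℝ}
    (hp : p ∈ stdSimplex ℝ (∀ i, X i)) (f : (∀ i, X i) → Y) (κ : Y → C) {ε : ℝ} (hε : 0 < ε) :
    Tendsto (fun F : ℕ => prob p (fun x : Block X F =>
      F * (ent p f - ent p (κ ∘ f) + ε) < ∑ t, infoDensity p f κ (f (x t)))) atTop (𝓝 0) := by
  obtain ⟨r, h0, h1, hr⟩ := exists_chernoff hp (fun s => infoDensity p f κ (f s)) hε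
  rw [sum_infoDensity] at hr
  exact squeeze_zero (fun F => prob_nonneg hp _) hr (tendsto_pow_atTop_nhds_zero_of_lt_one h0 h1)

theorem pmass_congr_ae {S T : Type*} [Fintype S] {p : S → ℝ} {f g : S → T}
    (h : ∀ s, p s ≠ 0 → f s = g s) (t : T) : pmass p f t = pmass p g t := by
  classical
  refine Finset.sum_congr rfl fun s _ => ?_
  by_cases hs : p s = 0
  · simp [Set.indicator_apply, hs]
  · simp [Set.indicator_apply, h s hs]

theorem ent_congr_ae {S T : Type*} [Fintype S] {p : S → ℝ} {f g : S → T}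
    (h : ∀ s, p s ≠ 0 → f s = g s) : ent p f = ent p g := by
  unfold ent
  congr 1
  refine Finset.sum_congr rfl fun s _ => ?_
  by_cases hs : p s = 0
  · simp [hs]
  · rw [pmass_congr_ae h, h s hs]

/-- If a common component `κ` can be computed from either file, then describing it in common and
each file conditionally on it is asymptotically lossless. -/
theorem mem_gwRegion_of_common {B : Type*} [Fintype B] {p : (∀ i, X i) → ℝ}
    (hp : p ∈ stdSimplex ℝ (∀ i, X i)) (κ : ∀ i, X i → B)
    (hκ : ∀ y, p y ≠ 0 → κ 0 (y 0) = κ 1 (y 1)) :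
    (ent p (fun y => κ 0 (y 0)), fun i => ent p (fun y => y i) - ent p (fun y => κ i (y i))) ∈
      gwRegion p := by
  classical
  set h₀ := ent p (fun y => κ 0 (y 0)) with hh₀
  set a : Fin 2 → ℝ := fun i => ent p (fun y => y i) - ent p (fun y => κ i (y i)) with ha
  have hh₀0 : 0 ≤ h₀ := by
    rw [← ent_const hp ()]
    exact ent_mono hp.1 (by simp)
  have ha0 : ∀ i, 0 ≤ a i := fun i =>
    sub_nonneg.2 (ent_mono hp.1 fun s s' e => congrArg (κ i) e)
  have hκb : ∀ F (x : Block X F), 0 < blockPmf p F x → ∀ i t, κ i (x t i) = κ 0 (x t 0) := by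
    intro F x hx i t
    have := hκ (x t) fun h => hx.ne' (Finset.prod_eq_zero (Finset.mem_univ t) h)
    fin_cases i
    · rfl
    · exact this.symm
  rw [gwRegion, Metric.mem_closure_iff]
  intro ε hε
  have hε2 : 0 < ε / 2 := by positivity
  -- Every rate exceeds its entropy by `ε / 2`, which leaves room for the law of large numbers while
  -- staying within distance `ε`.
  refine ⟨(h₀ + ε / 2, fun i => a i + ε / 2), ?_, ?_⟩
  swap
  · have : dist (h₀, a) (h₀ + ε / 2, fun i => a i + ε / 2) ≤ ε / 2 := by
      rw [Prod.dist_eq, max_le_iff]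
      refine ⟨by simp [abs_of_pos hε], (dist_pi_le_iff hε2.le).2 fun i => by simp [abs_of_pos hε]⟩
    linarith
  -- the bad events
  let bad₀ : ∀ F, Block X F → Prop := fun F x => F * (ent p (fun y => κ 0 (y 0)) -
    ent p ((fun _ => ()) ∘ (fun y : ∀ i, X i => κ 0 (y 0))) + ε / 2) <
      ∑ t, infoDensity p (fun y : ∀ i, X i => κ 0 (y 0)) (fun _ => ()) (κ 0 (x t 0))
  let bad : ∀ F, Fin 2 → Block X F → Prop := fun F i x => F * (ent p (fun y => y i) -
    ent p (κ i ∘ (fun y : ∀ i, X i => y i)) + ε / 2) <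
      ∑ t, infoDensity p (fun y : ∀ i, X i => y i) (κ i) (x t i)
  -- Positive probability is included because it makes the common component computed from the two
  -- files agree at every coordinate. `bad₀` conditions on a constant, so its threshold involves the
  -- plain entropy of the common component.
  let good : ∀ F, Block X F → Prop := fun F x => 0 < blockPmf p F x ∧ ¬(bad₀ F x ∨ bad F 0 x ∨
    bad F 1 x)
  have hcode : ∀ F, ∃ C : GWCode X F (h₀ + ε / 2, fun i => a i + ε / 2),
      C.errorProb p ≤ prob p (fun x => ¬good F x) := by
    intro F
    set L₀ : ℝ := F * (h₀ + ε / 2)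
    set L : Fin 2 → ℝ := fun i => F * (a i + ε / 2)
    have hfl : ∀ l : ℝ, 0 ≤ l → 0 < ⌊(2 : ℝ) ^ l⌋₊ := fun l hl =>
      Nat.floor_pos.2 (Real.one_le_rpow one_le_two hl)
    have hL₀ : 0 ≤ L₀ := by positivity
    have hL : ∀ i, 0 ≤ L i := fun i => mul_nonneg (by positivity) (by linarith [ha0 i])
    obtain ⟨e₀, he₀⟩ := exists_injOn_fin (typicalSet p (fun y : ∀ i, X i => κ 0 (y 0))
      (fun _ => ()) L₀ (fun _ : Fin F => ())) (hfl L₀ hL₀)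
      (Nat.le_floor (card_typicalSet_le hp.1 _ _ _ _))
    -- The private index is relative to the common block `c`: one injection for each conditional
    -- typical set. The decoder can use it because the common description already determines `c`.
    choose e he using fun (i : Fin 2) (c : Fin F → B) => exists_injOn_fin
      (typicalSet p (fun y : ∀ i, X i => y i) (κ i) (L i) c) (hfl (L i) (hL i))
      (Nat.le_floor (card_typicalSet_le hp.1 _ _ _ _))
    refine exists_gwCode hp (Nat.floor_le (by positivity)) (fun i => Nat.floor_le (by positivity))
      (fun x => e₀ fun t => κ 0 (x t 0))
      (fun i x => e i (fun t => κ 0 (x t 0)) (file x i)) (good F) ?_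
    intro x x' hx hx' hc i hi
    have hV : ∀ x, good F x → (fun t => κ 0 (x t 0)) ∈ typicalSet p
        (fun y : ∀ i, X i => κ 0 (y 0)) (fun _ => ()) L₀ (fun _ : Fin F => ()) := by
      intro x hx
      have hb := not_or.1 hx.2
      simp only [typicalSet, Finset.mem_filter, Finset.mem_univ, true_and, implies_true]
      refine ⟨fun t => pmass_pos hp.1 (fun y : ∀ i, X i => κ 0 (y 0)) (s := x t) ?_, ?_⟩
      · exact (hp.1 _).lt_of_ne' fun h => hx.1.ne' (Finset.prod_eq_zero (Finset.mem_univ t) h)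
      · have := not_lt.1 hb.1
        have e : ent p ((fun _ => ()) ∘ (fun y : ∀ i, X i => κ 0 (y 0))) = 0 := ent_const hp ()
        rw [e, sub_zero] at this
        exact this
    have hT : ∀ x, good F x → file x i ∈ typicalSet p (fun y : ∀ i, X i => y i) (κ i) (L i)
        (fun t => κ 0 (x t 0)) := by
      intro x hx
      have hb := not_or.1 hx.2
      have hb2 := not_or.1 hb.2
      simp only [typicalSet, Finset.mem_filter, Finset.mem_univ, true_and]
      refine ⟨hκb F x hx.1 i, fun t => pmass_pos hp.1 (fun y : ∀ i, X i => y i) (s := x t) ?_, ?_⟩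
      · exact (hp.1 _).lt_of_ne' fun h => hx.1.ne' (Finset.prod_eq_zero (Finset.mem_univ t) h)
      · have : ¬bad F i x := by
          fin_cases i
          · exact hb2.1
          · exact hb2.2
        exact not_lt.1 this
    have hv := he₀ (hV x hx) (hV x' hx') hc
    have h1 := hT x hx
    have h2 := hT x' hx'
    simp only [← hv] at hi h2
    exact he i _ h1 h2 hi
  choose C hC using hcode
  refine ⟨C, ?_⟩
  have hlim := (tendsto_prob_infoDensity hp (fun y => κ 0 (y 0)) (fun _ => ()) hε2).add
    ((tendsto_prob_infoDensity hp (fun y => y 0) (κ 0) hε2).add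
      (tendsto_prob_infoDensity hp (fun y => y 1) (κ 1) hε2))
  simp only [add_zero] at hlim
  refine squeeze_zero (fun F => prob_nonneg hp _) (fun F => (hC F).trans ?_) hlim
  refine (prob_mono hp (E' := fun x => bad₀ F x ∨ bad F 0 x ∨ bad F 1 x) fun x hx h => ?_).trans
    ((prob_or_le hp _ _).trans (add_le_add le_rfl (prob_or_le hp _ _)))
  by_contra hb
  exact h ⟨hx, hb⟩

end GWCodes

/-! ### Gray-Wyner codes combined with multiple-request schemes -/

section Composition

variable {X : Fin 2 → Type*} [∀ i, Fintype (X i)] {K : ℕ}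

theorem exists_bits {N n : ℕ} (h : N ≤ 2 ^ n) :
    ∃ b : Fin N → List Bool, Function.Injective b ∧ ∀ j, (b j).length = n := by
  have : Fintype.card (Fin N) ≤ Fintype.card (List.Vector Bool n) := by
    simpa [card_vector] using h
  obtain ⟨e⟩ := Function.Embedding.nonempty_of_card_le this
  exact ⟨fun j => (e j).1, fun a b hab => e.injective (Subtype.ext hab), fun j => (e j).2⟩

theorem le_two_pow_of_le_rpow {N F : ℕ} {r r' δ : ℝ} (hr : r' ≤ r + δ)
    (h : (N : ℝ) ≤ 2 ^ (F * r')) : N ≤ 2 ^ (descBits r F + ⌈F * δ⌉₊) := by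
  have h1 : (F : ℝ) * r' ≤ (descBits r F + ⌈F * δ⌉₊ : ℕ) := by
    have h2 := Nat.le_ceil (F * r)
    have h3 := Nat.le_ceil (F * δ)
    have h4 := mul_le_mul_of_nonneg_left hr (Nat.cast_nonneg (α := ℝ) F)
    push_cast
    unfold descBits
    linarith
  have := h.trans (Real.rpow_le_rpow_of_exponent_le one_le_two h1)
  rw [Real.rpow_natCast] at this
  exact_mod_cast this

open Classical in
/-- A multiple-request scheme applied to the descriptions of a Gray-Wyner code; what exceeds the
nominal rates `ρ` of the descriptions is sent uncoded. -/
theorem exists_cacmScheme {p : (∀ i, X i) → ℝ} (hp : p ∈ stdSimplex ℝ (∀ i, X i)) {F : ℕ}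
    {ρ ρ' : ℝ × (Fin 2 → ℝ)} {δ M : ℝ} (h₀ : ρ'.1 ≤ ρ.1 + δ) (h : ∀ i, ρ'.2 i ≤ ρ.2 i + δ)
    (C : GWCode X F ρ') (S : MRScheme K) (hM : (S.cacheLoad ρ F : ℝ) ≤ M * F) :
    ∃ T : CACMScheme X K F M, T.errorProb p ≤ C.errorProb p ∧
      ∀ d, T.expectedLength p d = S.codeLoad ρ F d + 3 * ⌈F * δ⌉₊ := by
  have hX := nonempty_of_mem_stdSimplex hp
  obtain ⟨b₀, hb₀, hl₀⟩ := exists_bits (le_two_pow_of_le_rpow h₀ C.commonSize_le)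
  choose b hb hl using fun i => exists_bits (le_two_pow_of_le_rpow (h i) (C.privSize_le i))
  set n₀ := descBits ρ.1 F
  set n : Fin 2 → ℕ := fun i => descBits (ρ.2 i) F with hn
  -- Each index is padded to the nominal length plus `⌈F δ⌉` bits. The nominal part enters the
  -- multiple-request scheme; the three excess parts are appended to every codeword.
  let w₀ : Block X F → List Bool := fun x => (b₀ (C.encCommon x)).take n₀
  let w : Block X F → Fin 2 → List Bool := fun x i => (b i (C.encPriv i x)).take (n i)
  let e₀ : Block X F → List Bool := fun x => (b₀ (C.encCommon x)).drop n₀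
  let e : Fin 2 → Block X F → List Bool := fun i x => (b i (C.encPriv i x)).drop (n i)
  have hw₀ : ∀ x, (w₀ x).length = n₀ := fun x => by simp [w₀, hl₀]
  have hw : ∀ x i, (w x i).length = n i := fun x i => by simp [w, hl, hn]
  have he₀ : ∀ x, (e₀ x).length = ⌈F * δ⌉₊ := fun x => by simp [e₀, hl₀]
  have he : ∀ i x, (e i x).length = ⌈F * δ⌉₊ := fun i x => by simp [e, hl, hn]
  have hplace : ∀ k x, (S.place k (w₀ x) (w x)).length = S.cacheLoad ρ F := fun k x => by
    rw [S.place_length, hw₀]; simp only [hw]; rfl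
  obtain ⟨E⟩ : Nonempty (List.Vector Bool (S.cacheLoad ρ F) ≃ Fin (2 ^ S.cacheLoad ρ F)) :=
    ⟨Fintype.equivFinOfCardEq (by simp [card_vector])⟩
  let Z : Fin K → Block X F → Fin (2 ^ S.cacheLoad ρ F) := fun k x =>
    E ⟨S.place k (w₀ x) (w x), hplace k x⟩
  let Y : Demand K → Block X F → List Bool := fun d x =>
    S.deliver d (w₀ x) (w x) ++ (e₀ x ++ (e 0 x ++ e 1 x))
  let good : Block X F → Prop := fun x => ∀ i, C.decode i (C.encCommon x) (C.encPriv i x) = file x i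
  have hkey : ∀ x x' d k, good x → good x' → Z k x = Z k x' → Y d x = Y d x' →
      file x (d k) = file x' (d k) := by
    intro x x' d k hx hx' hZ hY
    obtain ⟨y1, hY⟩ := List.append_inj hY (by
      rw [S.deliver_length, S.deliver_length, hw₀, hw₀]; simp only [hw])
    obtain ⟨y2, hY⟩ := List.append_inj hY (by rw [he₀, he₀])
    obtain ⟨y3, y4⟩ := List.append_inj hY (by rw [he, he])
    have hz := congrArg Subtype.val (E.injective hZ)
    obtain ⟨d1, d2⟩ := S.decodable d k _ _ _ _ (by rw [hw₀, hw₀]) (fun i => by rw [hw, hw]) hz y1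
    have hc : C.encCommon x = C.encCommon x' := hb₀ (by
      rw [← List.take_append_drop n₀ (b₀ (C.encCommon x)),
        ← List.take_append_drop n₀ (b₀ (C.encCommon x'))]
      exact congrArg₂ _ d1 y2)
    have hp : C.encPriv (d k) x = C.encPriv (d k) x' := hb (d k) (by
      rw [← List.take_append_drop (n (d k)) (b (d k) (C.encPriv (d k) x)),
        ← List.take_append_drop (n (d k)) (b (d k) (C.encPriv (d k) x'))]
      refine congrArg₂ _ d2 ?_
      have : ∀ i, e i x = e i x' := fun i => by
        fin_cases i
        · exact y3
        · exact y4
      exact this (d k))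
    rw [← hx, ← hx', hc, hp]
  have hsize : ((2 ^ S.cacheLoad ρ F : ℕ) : ℝ) ≤ 2 ^ (M * F) := by
    rw [Nat.cast_pow, Nat.cast_ofNat, ← Real.rpow_natCast]
    exact Real.rpow_le_rpow_of_exponent_le one_le_two hM
  let T : CACMScheme X K F M :=
    { cacheSize := 2 ^ S.cacheLoad ρ F
      cacheSize_le := hsize
      cache := Z
      multicast := fun d _ x => Y d x
      -- Any good block compatible with the cache and the codeword will do, since by `hkey` all of
      -- them have the same requested file.
      decode := fun k d y z => if h : ∃ x, good x ∧ Z k x = z ∧ Y d x = y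
        then file h.choose (d k) else fun _ => hX.some (d k) }
  refine ⟨T, ciSup_le fun d => prob_mono hp fun x _ hx => ?_, fun d => ?_⟩
  · by_contra hg
    simp only [not_exists, not_not] at hg
    obtain ⟨k, hk⟩ := hx
    have hex : ∃ x', good x' ∧ Z k x' = Z k x ∧ Y d x' = Y d x := ⟨x, hg, rfl, rfl⟩
    have hT : T.decode k d (T.codeword d x) (T.cache k x) = file hex.choose (d k) := dif_pos hex
    rw [hT] at hk
    have hs := hex.choose_spec
    exact hk (hkey _ _ d k hs.1 hg hs.2.1 hs.2.2)
  · have hlen : ∀ x, ((T.codeword d x).length : ℝ) = S.codeLoad ρ F d + 3 * ⌈F * δ⌉₊ := by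
      intro x
      have : (T.codeword d x).length = S.codeLoad ρ F d + 3 * ⌈F * δ⌉₊ := by
        change (Y d x).length = _
        simp only [Y, List.length_append, S.deliver_length, hw₀, hw, he₀, he]
        change S.codeLoad ρ F d + _ = _
        ring
      exact_mod_cast this
    change ∑ x, blockPmf p F x * ((T.codeword d x).length : ℝ) = _
    rw [Finset.sum_congr rfl fun x _ => by rw [hlen x], ← Finset.sum_mul, (blockPmf_mem hp F).2,
      one_mul]

/-- A scheme without caching and transmission. -/
noncomputable def CACMScheme.trivial [Nonempty (∀ i, X i)] {F : ℕ} {M : ℝ} (hM : 0 ≤ M) :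
    CACMScheme X K F M where
  cacheSize := 1
  cacheSize_le := by
    rw [Nat.cast_one]
    exact Real.one_le_rpow one_le_two (by positivity)
  cache _ _ := 0
  multicast _ _ _ := []
  decode _ d _ _ := fun _ => Classical.arbitrary (∀ i, X i) (d _)

theorem tendsto_ceil_overhead {δ ε : ℝ} (hδ : 0 ≤ δ) (h : 3 * δ < ε) :
    ∀ᶠ F : ℕ in atTop, 0 < F ∧ (3 * ⌈F * δ⌉₊ : ℝ) / F ≤ ε := by
  have hlim : Tendsto (fun F : ℕ => 3 * δ + 3 / (F : ℝ)) atTop (𝓝 (3 * δ + 0)) :=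
    tendsto_const_nhds.add (tendsto_const_div_atTop_nhds_zero_nat 3)
  filter_upwards [hlim.eventually_lt_const (by simpa using h), eventually_gt_atTop 0] with F h1 h2
  refine ⟨h2, le_trans ?_ h1.le⟩
  have hF : (0 : ℝ) < F := by exact_mod_cast h2
  rw [div_le_iff₀ hF]
  have := Nat.ceil_lt_add_one (mul_nonneg hF.le hδ)
  field_simp
  nlinarith

/-- A family of multiple-request schemes turns into a family of CACM schemes. -/
theorem exists_cacm_family {p : (∀ i, X i) → ℝ} (hp : p ∈ stdSimplex ℝ (∀ i, X i))
    {ρ : ℝ × (Fin 2 → ℝ)} (hρ : ρ ∈ gwRegion p) (S : ℕ → MRScheme K) {M : ℝ}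
    (hM : ∀ᶠ F : ℕ in atTop, ((S F).cacheLoad ρ F : ℝ) ≤ M * F) {ε : ℝ} (hε : 0 < ε) :
    ∃ T : ∀ F : ℕ, CACMScheme X K F M, Tendsto (fun F => (T F).errorProb p) atTop (𝓝 0) ∧
      ∀ᶠ F : ℕ in atTop, ∀ d, (T F).expectedLength p d / F ≤ ((S F).codeLoad ρ F d : ℝ) / F + ε := by
  classical
  have hX := nonempty_of_mem_stdSimplex hp
  have hM0 : 0 ≤ M := by
    obtain ⟨F, h1, h2⟩ := (hM.and (eventually_gt_atTop 0)).exists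
    have hF : (0 : ℝ) < F := by exact_mod_cast h2
    exact nonneg_of_mul_nonneg_left ((Nat.cast_nonneg _).trans h1) hF
  -- Three descriptions may each exceed their nominal rate by `ε / 4`; `3ε / 4 < ε` leaves room for
  -- rounding.
  obtain ⟨ρ', ⟨C, hC⟩, hd⟩ := Metric.mem_closure_iff.1 hρ (ε / 4) (by positivity)
  rw [Prod.dist_eq, max_lt_iff] at hd
  have h₀ : ρ'.1 ≤ ρ.1 + ε / 4 := by
    have := (abs_lt.1 (Real.dist_eq _ _ ▸ hd.1)).1; linarith
  have h : ∀ i, ρ'.2 i ≤ ρ.2 i + ε / 4 := fun i => by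
    have := (abs_lt.1 (Real.dist_eq _ _ ▸ (dist_le_pi_dist ρ.2 ρ'.2 i).trans_lt hd.2)).1; linarith
  -- The cache constraint holds only eventually, whereas a family needs a scheme at every `F`; the
  -- trivial scheme fills the remaining block lengths.
  have hex : ∀ F : ℕ, ∃ T : CACMScheme X K F M, ((S F).cacheLoad ρ F : ℝ) ≤ M * F →
      T.errorProb p ≤ (C F).errorProb p ∧
      ∀ d, T.expectedLength p d = (S F).codeLoad ρ F d + 3 * ⌈F * (ε / 4)⌉₊ := by
    intro F
    by_cases hF : ((S F).cacheLoad ρ F : ℝ) ≤ M * F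
    · obtain ⟨T, hT⟩ := exists_cacmScheme hp h₀ h (C F) (S F) hF
      exact ⟨T, fun _ => hT⟩
    · exact ⟨CACMScheme.trivial hM0, fun h => absurd h hF⟩
  choose T hT using hex
  refine ⟨T, ?_, ?_⟩
  · refine squeeze_zero' (Eventually.of_forall fun F => ?_) ?_ hC
    · exact (prob_nonneg hp _).trans ((T F).prob_errs_le p (fun _ => 0))
    · filter_upwards [hM] with F hF using (hT F hF).1
  · filter_upwards [hM, tendsto_ceil_overhead (δ := ε / 4) (ε := ε) (by positivity) (by linarith)]
      with F hF h2 d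
    rw [(hT F hF).2 d, add_div]
    linarith [h2.2]

theorem mem_closure_of_forall_add {𝒜 : Set (ℝ × ℝ)} {R M : ℝ}
    (h : ∀ ε > 0, (R + ε, M) ∈ 𝒜) : (R, M) ∈ closure 𝒜 := by
  rw [Metric.mem_closure_iff]
  intro ε hε
  refine ⟨_, h (ε / 2) (by positivity), ?_⟩
  rw [Prod.dist_eq]
  simp [abs_of_pos hε, hε]

/-- Composing a Gray–Wyner code with the proposed scheme gives an ordinary caching scheme. This
transfers the converse to every operating point of the region, not only to the one used for
achievability. -/
theorem closure_proposedPeak_subset {p : (∀ i, X i) → ℝ} (hp : p ∈ stdSimplex ℝ (∀ i, X i))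
    {ρ : ℝ × (Fin 2 → ℝ)} (hρ : ρ ∈ gwRegion p) :
    closure (proposedPeakAchievable K ρ) ⊆ closure (peakAchievable p K) := by
  refine closure_minimal (fun z hz => ?_) isClosed_closure
  obtain ⟨μ₀, -, P, -, hM, hR⟩ := hz
  refine mem_closure_of_forall_add fun ε hε => ?_
  obtain ⟨T, hT, hlen⟩ := exists_cacm_family hp hρ _ hM hε
  refine ⟨T, hT, fun η hη => ?_⟩
  filter_upwards [hlen, hR η hη] with F h1 h2
  refine ciSup_le fun d => (h1 d).trans ?_
  have := le_ciSup (f := fun d => ((proposedMR ⌊F * μ₀⌋₊ P).codeLoad ρ F d : ℝ) / F)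
    (Set.finite_range _).bddAbove d
  have := this.trans h2
  linarith

theorem closure_proposedAvg_subset {p : (∀ i, X i) → ℝ} (hp : p ∈ stdSimplex ℝ (∀ i, X i))
    {ρ : ℝ × (Fin 2 → ℝ)} (hρ : ρ ∈ gwRegion p) :
    closure (proposedAvgAchievable K ρ) ⊆ closure (avgAchievable p K) := by
  refine closure_minimal (fun z hz => ?_) isClosed_closure
  obtain ⟨μ₀, -, P, -, hM, hR⟩ := hz
  refine mem_closure_of_forall_add fun ε hε => ?_
  obtain ⟨T, hT, hlen⟩ := exists_cacm_family hp hρ _ hM hε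
  refine ⟨T, hT, fun η hη => ?_⟩
  filter_upwards [hlen, hR η hη] with F h1 h2
  have h3 : (T F).avgRate p ≤ (proposedMR ⌊F * μ₀⌋₊ P).avgRate ρ F + ε := by
    have := Finset.sum_le_sum fun d (_ : d ∈ Finset.univ) => h1 d
    rw [Finset.sum_add_distrib, ← Finset.sum_div, ← Finset.sum_div] at this
    simp only [Finset.sum_const, Finset.card_univ, Fintype.card_fun, Fintype.card_fin,
      nsmul_eq_mul, Nat.cast_pow, Nat.cast_ofNat] at this
    simp only [CACMScheme.avgRate, MRScheme.avgRate]
    rw [div_right_comm, div_right_comm (∑ d, _) ((2 : ℝ) ^ K), div_le_iff₀ (by positivity), add_mul,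
      div_mul_cancel₀ _ (by positivity)]
    linarith
  linarith

/-- Already at block length 1 each description takes at least one value, because blocks exist. -/
theorem nonneg_of_mem_gwRegion {p : (∀ i, X i) → ℝ} (hp : p ∈ stdSimplex ℝ (∀ i, X i))
    {ρ : ℝ × (Fin 2 → ℝ)} (hρ : ρ ∈ gwRegion p) : 0 ≤ ρ.1 ∧ ∀ i, 0 ≤ ρ.2 i := by
  have hX := nonempty_of_mem_stdSimplex hp
  have hcl : IsClosed {ρ : ℝ × (Fin 2 → ℝ) | 0 ≤ ρ.1 ∧ ∀ i, 0 ≤ ρ.2 i} := by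
    simp only [Set.ofPred_and, Set.ofPred_forall]
    exact (isClosed_le continuous_const continuous_fst).inter
      (isClosed_iInter fun i => isClosed_le continuous_const (by fun_prop))
  refine closure_minimal ?_ hcl hρ
  rintro ρ ⟨C, -⟩
  have key : ∀ {N : ℕ} {r : ℝ}, Nonempty (Fin N) → (N : ℝ) ≤ 2 ^ ((1 : ℕ) * r) → 0 ≤ r := by
    intro N r h1 h2
    by_contra hr
    have h3 : (1 : ℝ) ≤ N := by exact_mod_cast Fin.pos_iff_nonempty.2 h1
    have h4 : (2 : ℝ) ^ ((1 : ℕ) * r) < 1 :=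
      Real.rpow_lt_one_of_one_lt_of_neg one_lt_two (by push_cast; linarith)
    linarith
  let x : Block X 1 := fun _ => hX.some
  exact ⟨key ⟨(C 1).encCommon x⟩ (C 1).commonSize_le,
    fun i => key ⟨(C 1).encPriv i x⟩ ((C 1).privSize_le i)⟩

end Composition

/-! ### Asymptotic loads of the proposed schemes -/

section Loads

variable {K : ℕ}

theorem tendsto_natFloor_div {a : ℕ → ℝ} {r : ℝ} (ha : ∀ F, 0 ≤ a F)
    (h : Tendsto (fun F => a F / F) atTop (𝓝 r)) :
    Tendsto (fun F => (⌊a F⌋₊ : ℝ) / F) atTop (𝓝 r) := by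
  have h1 : Tendsto (fun F : ℕ => a F / F - 1 / F) atTop (𝓝 r) := by
    simpa using h.sub (tendsto_const_div_atTop_nhds_zero_nat 1)
  refine tendsto_of_tendsto_of_tendsto_of_le_of_le h1 h (fun F => ?_) (fun F => ?_)
  · dsimp only
    rw [← sub_div]
    have := Nat.lt_floor_add_one (a F)
    gcongr
    linarith
  · dsimp only
    gcongr
    exact Nat.floor_le (ha F)

theorem tendsto_descBits_div {r : ℝ} (hr : 0 ≤ r) :
    Tendsto (fun F => (descBits r F : ℝ) / F) atTop (𝓝 r) := by
  have h0 : ∀ᶠ F : ℕ in atTop, (0 : ℝ) < F := by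
    filter_upwards [eventually_gt_atTop 0] with F hF using by exact_mod_cast hF
  have h1 : Tendsto (fun F : ℕ => r + 1 / (F : ℝ)) atTop (𝓝 r) := by
    simpa using (tendsto_const_nhds (x := r)).add
      (tendsto_const_div_atTop_nhds_zero_nat (𝕜 := ℝ) 1)
  refine tendsto_of_tendsto_of_tendsto_of_le_of_le' tendsto_const_nhds h1 ?_ ?_
  · filter_upwards [h0] with F hF
    rw [le_div_iff₀ hF, mul_comm]
    exact Nat.le_ceil _
  · filter_upwards [h0] with F hF
    rw [div_le_iff₀ hF, add_mul, one_div, inv_mul_cancel₀ hF.ne', mul_comm r]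
    exact (Nat.ceil_lt_add_one (mul_nonneg hF.le hr)).le

/-- For strings of asymptotic rates `r`, the scheme `P` has asymptotic cache load `c` and
asymptotic delivery loads `e`. -/
def HasLoad (P : PrivateScheme K) (r : Fin 2 → ℝ) (c : ℝ) (e : Demand K → ℝ) : Prop :=
  ∀ n : ℕ → Fin 2 → ℕ, (∀ i, Tendsto (fun F => (n F i : ℝ) / F) atTop (𝓝 (r i))) →
    Tendsto (fun F => (P.cacheBits (n F) : ℝ) / F) atTop (𝓝 c) ∧
    ∀ d, Tendsto (fun F => (P.codeBits d (n F) : ℝ) / F) atTop (𝓝 (e d))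

/-- `HasLoad` quantifies over all length sequences with the given rates, so it applies to the two
pieces of the cut strings, whose rates are `t r` and `(1 - t) r`. -/
theorem HasLoad.memoryShare {P Q : PrivateScheme K} {r : Fin 2 → ℝ} {t c c' : ℝ}
    {e e' : Demand K → ℝ} (ht : t ∈ Set.Icc (0 : ℝ) 1) (hP : HasLoad P (fun i => t * r i) c e)
    (hQ : HasLoad Q (fun i => (1 - t) * r i) c' e') :
    HasLoad (memoryShare t P Q) r (c + c') (fun d => e d + e' d) := by
  intro n hn
  have hle : ∀ m : ℕ, cut t m ≤ m := fun m =>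
    Nat.floor_le_of_le (mul_le_of_le_one_left (Nat.cast_nonneg m) ht.2)
  have hcut : ∀ i, Tendsto (fun F => (cut t (n F i) : ℝ) / F) atTop (𝓝 (t * r i)) := fun i =>
    tendsto_natFloor_div (fun F => mul_nonneg ht.1 (Nat.cast_nonneg _)) (by
      simpa only [mul_div_assoc] using (hn i).const_mul t)
  obtain ⟨p1, p2⟩ := hP (fun F i => min (cut t (n F i)) (n F i)) (fun i => by
    simp only [min_eq_left (hle _)]; exact hcut i)
  obtain ⟨q1, q2⟩ := hQ (fun F i => n F i - cut t (n F i)) (fun i => by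
    simp only [Nat.cast_sub (hle _), sub_div, sub_mul, one_mul]
    exact (hn i).sub (hcut i))
  refine ⟨?_, fun d => ?_⟩
  · simpa only [GWCaching.memoryShare, Nat.cast_add, add_div] using p1.add q1
  · simpa only [GWCaching.memoryShare, Nat.cast_add, add_div] using (p2 d).add (q2 d)

/-- Total rate of the requested strings. -/
noncomputable def requestedRate (d : Demand K) (r : Fin 2 → ℝ) : ℝ :=
  (if Requested d 0 then r 0 else 0) + (if Requested d 1 then r 1 else 0)

theorem tendsto_requestedBits (d : Demand K) {n : ℕ → Fin 2 → ℕ} {r : Fin 2 → ℝ}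
    (hn : ∀ i, Tendsto (fun F => (n F i : ℝ) / F) atTop (𝓝 (r i))) :
    Tendsto (fun F => (requestedBits d (n F) : ℝ) / F) atTop (𝓝 (requestedRate d r)) := by
  simp only [requestedBits, requestedRate, Nat.cast_add, add_div]
  refine Tendsto.add ?_ ?_
  · split_ifs
    · exact hn 0
    · simp
  · split_ifs
    · exact hn 1
    · simp

theorem hasLoad_noCaching (r : Fin 2 → ℝ) :
    HasLoad (noCaching K) r 0 (fun d => requestedRate d r) := fun n hn =>
  ⟨by simp [noCaching], fun d => tendsto_requestedBits d hn⟩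

theorem hasLoad_fullCaching (r : Fin 2 → ℝ) :
    HasLoad (fullCaching K) r (r 0 + r 1) (fun _ => 0) := fun n hn =>
  ⟨by simpa only [fullCaching, Nat.cast_add, add_div] using (hn 0).add (hn 1),
    fun d => by simp [fullCaching]⟩

theorem tendsto_packetSize (K : ℕ) {n : ℕ → Fin 2 → ℕ} {r : Fin 2 → ℝ}
    (hn : ∀ i, Tendsto (fun F => (n F i : ℝ) / F) atTop (𝓝 (r i))) :
    Tendsto (fun F => (packetSize K (n F) : ℝ) / F) atTop (𝓝 (min (r 0) (r 1) / K)) := by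
  have h : ∀ F, packetSize K (n F) = ⌊((min (n F 0) (n F 1) : ℕ) : ℝ) / K⌋₊ := fun F => by
    rw [Nat.floor_div_eq_div]; rfl
  simp only [h]
  refine tendsto_natFloor_div (fun F => by positivity) ?_
  have := ((hn 0).min (hn 1)).div_const (K : ℝ)
  refine this.congr fun F => ?_
  rw [min_div_div_right (Nat.cast_nonneg F), Nat.cast_min]
  ring

theorem tendsto_leftover (hK : 0 < K) {n : ℕ → Fin 2 → ℕ} {r : Fin 2 → ℝ}
    (hn : ∀ i, Tendsto (fun F => (n F i : ℝ) / F) atTop (𝓝 (r i))) (i : Fin 2) :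
    Tendsto (fun F => ((n F i - K * packetSize K (n F) : ℕ) : ℝ) / F) atTop
      (𝓝 (r i - min (r 0) (r 1))) := by
  have hK' : (K : ℝ) ≠ 0 := by positivity
  simp only [Nat.cast_sub (packetSize_le _ i), sub_div, Nat.cast_mul, mul_div_assoc]
  have := (hn i).sub ((tendsto_packetSize K hn).const_mul (K : ℝ))
  rwa [mul_div_cancel₀ _ hK'] at this

theorem hasLoad_codedCaching (hK : 0 < K) (r : Fin 2 → ℝ) :
    HasLoad (codedCaching K) r (min (r 0) (r 1) / K) (fun d =>
      if Requested d 0 ∧ Requested d 1 then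
        (K + (samePairs d).length) * (min (r 0) (r 1) / K) +
          ((r 0 - min (r 0) (r 1)) + (r 1 - min (r 0) (r 1)))
      else requestedRate d r) := by
  refine fun n hn => ⟨tendsto_packetSize K hn, fun d => ?_⟩
  by_cases h : Requested d 0 ∧ Requested d 1
  · simp only [codedCaching, h, and_self, if_true, Nat.cast_add, Nat.cast_mul, add_div,
      mul_div_assoc]
    exact ((tendsto_packetSize K hn).const_mul _).add
      ((tendsto_leftover hK hn 0).add (tendsto_leftover hK hn 1))
  · simp only [codedCaching, h, if_false]
    exact tendsto_requestedBits d hn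

theorem hasLoad_uncodedCaching (hK : 0 < K) (r : Fin 2 → ℝ) :
    HasLoad (uncodedCaching K) r (min (r 0) (r 1) / K + min (r 0) (r 1) / K) (fun d =>
      (leaderPairs d).length * (min (r 0) (r 1) / K) +
        requestedRate d (fun i => r i - min (r 0) (r 1))) := by
  refine fun n hn => ⟨?_, fun d => ?_⟩
  · simp only [uncodedCaching, Nat.cast_add, add_div]
    exact (tendsto_packetSize K hn).add (tendsto_packetSize K hn)
  · simp only [uncodedCaching, Nat.cast_add, Nat.cast_mul, add_div, mul_div_assoc]
    exact ((tendsto_packetSize K hn).const_mul _).add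
      (tendsto_requestedBits d (tendsto_leftover hK hn))

theorem hasLoad_allButOneCaching (hK : 0 < K) (r : Fin 2 → ℝ) :
    HasLoad (allButOneCaching K) r (r 0 + r 1 - 2 / K * min (r 0) (r 1))
      (fun _ => min (r 0) (r 1) / K) := by
  refine fun n hn => ⟨?_, fun d => tendsto_packetSize K hn⟩
  have hs := (tendsto_packetSize K hn).const_mul ((K - 1 : ℕ) : ℝ)
  have := hs.add (hs.add ((tendsto_leftover hK hn 0).add (tendsto_leftover hK hn 1)))
  simp only [allButOneCaching, Nat.cast_add, Nat.cast_mul, add_div, mul_div_assoc]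
  convert this using 2
  have hK' : (K : ℝ) ≠ 0 := by positivity
  rw [Nat.cast_pred hK]
  field_simp
  ring

/-- A pair is determined by its second entry, because the leader of a file is unique; that entry is
never a leader, and two requested files have two distinct leaders. -/
theorem samePairs_length_le {d : Demand K} (h : Requested d 0 ∧ Requested d 1) :
    (samePairs d).length + 2 ≤ K := by
  obtain ⟨⟨a, ha⟩, ⟨b, hb⟩⟩ := h
  obtain ⟨u, hu, hua, -⟩ := exists_leader d a
  obtain ⟨v, hv, hvb, -⟩ := exists_leader d b
  have huv : u ≠ v := by
    rintro rfl
    rw [hua, ha] at hvb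
    rw [hb] at hvb
    exact absurd hvb (by decide)
  have hnd : (samePairs d).Nodup :=
    ((List.nodup_finRange K).product (List.nodup_finRange K)).filter _
  have hmem : ∀ z ∈ samePairs d, IsLeader d z.1 ∧ z.1 < z.2 ∧ d z.2 = d z.1 := fun z hz =>
    mem_pairsWith.1 hz
  have hinj : Set.InjOn Prod.snd ((samePairs d).toFinset : Set (Fin K × Fin K)) := by
    intro z hz z' hz' e
    have h1 := hmem z (by simpa using hz)
    have h2 := hmem z' (by simpa using hz')
    refine Prod.ext ?_ e
    have e' : d z.1 = d z'.1 := by rw [← h1.2.2, ← h2.2.2, e]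
    rcases lt_trichotomy z.1 z'.1 with h | h | h
    · exact absurd e' (h2.1 _ h)
    · exact h
    · exact absurd e'.symm (h1.1 _ h)
  have hsub : ∀ z ∈ (samePairs d).toFinset, z.2 ∈ (Finset.univ \ {u, v} : Finset (Fin K)) := by
    intro z hz
    have h1 := hmem z (by simpa using hz)
    simp only [Finset.mem_sdiff, Finset.mem_univ, true_and, Finset.mem_insert,
      Finset.mem_singleton]
    rintro (rfl | rfl)
    · exact hu _ h1.2.1 h1.2.2.symm
    · exact hv _ h1.2.1 h1.2.2.symm
  have := Finset.card_le_card_of_injOn Prod.snd hsub hinj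
  rw [List.toFinset_card_of_nodup hnd, Finset.card_sdiff_of_subset (Finset.subset_univ _),
    Finset.card_univ, Fintype.card_fin, Finset.card_pair huv] at this
  have h2 : ({u, v} : Finset (Fin K)).card ≤ Fintype.card (Fin K) := Finset.card_le_univ _
  rw [Finset.card_pair huv, Fintype.card_fin] at h2
  omega

theorem requestedRate_le (d : Demand K) {r : Fin 2 → ℝ} (hr : ∀ i, 0 ≤ r i) :
    requestedRate d r ≤ r 0 + r 1 := by
  have := hr 0
  have := hr 1
  unfold requestedRate
  split_ifs <;> linarith

/-- With both files requested at most `K + (K - 2)` packets are sent besides the leftovers. A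
one-file demand costs at most `max = r 0 + r 1 - min`, which is no worse because `2 / K ≤ 1`. -/
theorem codedCaching_load_le (hK : 2 ≤ K) (d : Demand K) {r : Fin 2 → ℝ} (hr : ∀ i, 0 ≤ r i) :
    (if Requested d 0 ∧ Requested d 1 then
        (K + (samePairs d).length) * (min (r 0) (r 1) / K) +
          ((r 0 - min (r 0) (r 1)) + (r 1 - min (r 0) (r 1)))
      else requestedRate d r) ≤ r 0 + r 1 - 2 / K * min (r 0) (r 1) := by
  have hm : 0 ≤ min (r 0) (r 1) := le_min (hr 0) (hr 1)
  have hm0 := min_le_left (r 0) (r 1)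
  have hm1 := min_le_right (r 0) (r 1)
  have hK' : (2 : ℝ) ≤ K := by exact_mod_cast hK
  have hK0 : (0 : ℝ) < K := by linarith
  set m := min (r 0) (r 1)
  by_cases h : Requested d 0 ∧ Requested d 1
  · rw [if_pos h]
    have h1 : ((samePairs d).length : ℝ) + 2 ≤ K := by exact_mod_cast samePairs_length_le h
    have h2 : (K + (samePairs d).length : ℝ) * (m / K) ≤ (2 * K - 2) * (m / K) :=
      mul_le_mul_of_nonneg_right (by linarith) (by positivity)
    have h3 : (2 * K - 2) * (m / K) = 2 * m - 2 / K * m := by field_simp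
    linarith
  · rw [if_neg h]
    have h1 : 2 / K * m ≤ m := mul_le_of_le_one_left hm ((div_le_one hK0).2 hK')
    have h2 : requestedRate d r ≤ max (r 0) (r 1) := by
      have := hr 0
      have := hr 1
      have := le_max_left (r 0) (r 1)
      have := le_max_right (r 0) (r 1)
      unfold requestedRate
      split_ifs with h3 h4
      · exact absurd ⟨h3, h4⟩ h
      all_goals linarith
    have h3 := min_add_max (r 0) (r 1)
    change m + _ = _ at h3
    linarith

theorem mem_closure_of_forall_memory {𝒜 : Set (ℝ × ℝ)} {R M : ℝ}
    (h : ∀ ε > 0, (R, M + ε) ∈ 𝒜) : (R, M) ∈ closure 𝒜 := by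
  rw [Metric.mem_closure_iff]
  intro ε hε
  refine ⟨_, h (ε / 2) (by positivity), ?_⟩
  rw [Prod.dist_eq]
  simp [abs_of_pos hε, hε]

theorem tendsto_proposedMR {ρ : ℝ × (Fin 2 → ℝ)} (hρ : ∀ i, 0 ≤ ρ.2 i) {μ₀ : ℝ}
    (hμ : μ₀ ∈ Set.Icc 0 ρ.1) {P : PrivateScheme K} {c : ℝ} {e : Demand K → ℝ}
    (hP : HasLoad P ρ.2 c e) :
    Tendsto (fun F : ℕ => ((proposedMR ⌊F * μ₀⌋₊ P).cacheLoad ρ F : ℝ) / F) atTop (𝓝 (μ₀ + c)) ∧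
    ∀ d, Tendsto (fun F : ℕ => ((proposedMR ⌊F * μ₀⌋₊ P).codeLoad ρ F d : ℝ) / F) atTop
      (𝓝 (ρ.1 - μ₀ + e d)) := by
  obtain ⟨h1, h2⟩ := hP (fun F i => descBits (ρ.2 i) F) fun i => tendsto_descBits_div (hρ i)
  have hfl : Tendsto (fun F : ℕ => (⌊F * μ₀⌋₊ : ℝ) / F) atTop (𝓝 μ₀) := by
    refine tendsto_natFloor_div (fun F => mul_nonneg (Nat.cast_nonneg _) hμ.1) ?_
    refine tendsto_const_nhds.congr' ?_
    filter_upwards [eventually_gt_atTop 0] with F hF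
    have : (F : ℝ) ≠ 0 := by positivity
    field_simp
  have hle : ∀ F : ℕ, ⌊F * μ₀⌋₊ ≤ descBits ρ.1 F := fun F =>
    (Nat.floor_le_floor (mul_le_mul_of_nonneg_left hμ.2 (Nat.cast_nonneg F))).trans
      (Nat.floor_le_ceil _)
  have h0 := tendsto_descBits_div (hμ.1.trans hμ.2)
  refine ⟨?_, fun d => ?_⟩
  · simp only [MRScheme.cacheLoad, proposedMR, min_eq_left (hle _), Nat.cast_add, add_div]
    exact hfl.add h1
  · simp only [MRScheme.codeLoad, proposedMR, Nat.cast_add, Nat.cast_sub (hle _), add_div, sub_div]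
    exact (h0.sub hfl).add (h2 d)

theorem eventually_le_mul_of_tendsto {a : ℕ → ℝ} {l b : ℝ} (h : Tendsto (fun F => a F / F) atTop (𝓝 l))
    (hl : l < b) : ∀ᶠ F : ℕ in atTop, a F ≤ b * F := by
  filter_upwards [h.eventually_lt_const hl, eventually_gt_atTop 0] with F h1 h2
  have hF : (0 : ℝ) < F := by exact_mod_cast h2
  exact ((div_lt_iff₀ hF).1 h1).le

/-- Limiting loads suffice although the cache constraint is exact for large `F`: the memory is
enlarged by `ε`, which the closure absorbs. -/
theorem mem_closure_proposedPeak {ρ : ℝ × (Fin 2 → ℝ)} (hρ : ∀ i, 0 ≤ ρ.2 i) {μ₀ : ℝ}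
    (hμ : μ₀ ∈ Set.Icc 0 ρ.1) {P : PrivateScheme K} (hP : P ∈ peakPrivate K) {c : ℝ}
    {e : Demand K → ℝ} (hL : HasLoad P ρ.2 c e) {R M : ℝ} (hM : μ₀ + c ≤ M)
    (hR : ∀ d, ρ.1 - μ₀ + e d ≤ R) : (R, M) ∈ closure (proposedPeakAchievable K ρ) := by
  obtain ⟨h1, h2⟩ := tendsto_proposedMR hρ hμ hL
  refine mem_closure_of_forall_memory fun ε hε => ⟨μ₀, hμ, P, hP,
    eventually_le_mul_of_tendsto h1 (by simp only; linarith), fun η hη => ?_⟩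
  filter_upwards [eventually_all.2 fun d =>
    (h2 d).eventually_lt_const (show _ < R + η by linarith [hR d])] with F hF
  exact ciSup_le fun d => (hF d).le

theorem mem_closure_proposedAvg {ρ : ℝ × (Fin 2 → ℝ)} (hρ : ∀ i, 0 ≤ ρ.2 i) {μ₀ : ℝ}
    (hμ : μ₀ ∈ Set.Icc 0 ρ.1) {P : PrivateScheme K} (hP : P ∈ avgPrivate K) {c : ℝ}
    {e : Demand K → ℝ} (hL : HasLoad P ρ.2 c e) {R M : ℝ} (hM : μ₀ + c ≤ M)
    (hR : ρ.1 - μ₀ + (∑ d, e d) / 2 ^ K ≤ R) : (R, M) ∈ closure (proposedAvgAchievable K ρ) := by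
  obtain ⟨h1, h2⟩ := tendsto_proposedMR hρ hμ hL
  refine mem_closure_of_forall_memory fun ε hε => ⟨μ₀, hμ, P, hP,
    eventually_le_mul_of_tendsto h1 (by simp only; linarith), fun η hη => ?_⟩
  have h3 : Tendsto (fun F : ℕ => (proposedMR ⌊F * μ₀⌋₊ P).avgRate ρ F) atTop
      (𝓝 (ρ.1 - μ₀ + (∑ d, e d) / 2 ^ K)) := by
    have := (tendsto_finsetSum Finset.univ fun d _ => h2 d).div_const ((2 : ℝ) ^ K)
    convert this using 2
    · rw [MRScheme.avgRate, ← Finset.sum_div, div_right_comm]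
    · rw [Finset.sum_add_distrib]
      simp only [Finset.sum_const, Finset.card_univ, Fintype.card_fun, Fintype.card_fin,
        nsmul_eq_mul, Nat.cast_pow, Nat.cast_ofNat]
      field_simp
  filter_upwards [h3.eventually_lt_const (hR.trans_lt (lt_add_of_pos_right R hη))] with F hF
  exact hF.le

end Loads

/-! ### Operating points of the proposed scheme -/

section Points

/-- Finds the memory-sharing parameter, including the degenerate segment `b = 0`. -/
theorem exists_fraction {a b : ℝ} (ha : 0 ≤ a) (hab : a ≤ b) :
    ∃ t ∈ Set.Icc (0 : ℝ) 1, t * b = a := by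
  rcases ha.eq_or_lt with rfl | h
  · exact ⟨0, by simp, by simp⟩
  · exact ⟨a / b, ⟨(div_pos h (h.trans_le hab)).le, (div_le_one (h.trans_le hab)).2 hab⟩,
      div_mul_cancel₀ _ (h.trans_le hab).ne'⟩

variable {K : ℕ} {ρ : ℝ × (Fin 2 → ℝ)} (h₀ : 0 ≤ ρ.1) (hρ : ∀ i, 0 ≤ ρ.2 i)
include h₀ hρ

/-- A real infimum over the empty set would be 0, so bounding the rate from below at every operating
point requires some rate to be attained there. -/
theorem proposedPeak_nonempty {M : ℝ} (hM : 0 ≤ M) :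
    (ρ.1 + (ρ.2 0 + ρ.2 1), M) ∈ closure (proposedPeakAchievable K ρ) :=
  mem_closure_proposedPeak hρ (μ₀ := 0) ⟨le_rfl, h₀⟩ (MemorySharing.base _ (by simp))
    (hasLoad_noCaching _) (by linarith) fun d => by linarith [requestedRate_le d hρ]

theorem proposedAvg_nonempty {M : ℝ} (hM : 0 ≤ M) :
    (ρ.1 + (∑ d : Demand K, requestedRate d ρ.2) / 2 ^ K, M) ∈
      closure (proposedAvgAchievable K ρ) :=
  mem_closure_proposedAvg hρ (μ₀ := 0) ⟨le_rfl, h₀⟩ (MemorySharing.base _ (by simp))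
    (hasLoad_noCaching _) (by linarith) (by linarith)

theorem proposedPeak_small (hK : 2 ≤ K) {M : ℝ} (hM : M ∈ Set.Icc 0 (min (ρ.2 0) (ρ.2 1) / K)) :
    (ρ.1 + ρ.2 0 + ρ.2 1 - 2 * M, M) ∈ closure (proposedPeakAchievable K ρ) := by
  -- A fraction `t` is cached with coded placement and the rest not at all; nothing of `W₀` is
  -- stored. Each cached bit saves two transmitted bits.
  obtain ⟨t, ht, htM⟩ := exists_fraction hM.1 hM.2
  have h1 : 0 ≤ 1 - t := by linarith [ht.2]
  have hL := (hasLoad_codedCaching (K := K) (by omega) (fun i => t * ρ.2 i)).memoryShare ht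
    (hasLoad_noCaching (fun i => (1 - t) * ρ.2 i))
  refine mem_closure_proposedPeak hρ (μ₀ := 0) ⟨le_rfl, h₀⟩ (MemorySharing.share t _ _ ht
    (MemorySharing.base _ (by simp)) (MemorySharing.base _ (by simp))) hL ?_ fun d => ?_
  · rw [← mul_min_of_nonneg _ _ ht.1, mul_div_assoc]
    linarith
  · have e1 := codedCaching_load_le hK d (r := fun i => t * ρ.2 i) fun i => mul_nonneg ht.1 (hρ i)
    have e2 := requestedRate_le d (r := fun i => (1 - t) * ρ.2 i) fun i => mul_nonneg h1 (hρ i)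
    have e3 : 2 / K * min (t * ρ.2 0) (t * ρ.2 1) = 2 * M := by
      rw [← mul_min_of_nonneg _ _ ht.1, ← htM]; ring
    simp only [e3] at e1
    linarith

omit h₀ hρ in
-- All-but-one caching sends one packet and omits two, so its load is half of the uncached private
-- rate; full caching extends this line to the endpoint. All of `W₀` is to be cached, hence the
-- memory `M - ρ.1`.
theorem hasLoad_large (hK : 2 ≤ K) {M : ℝ} (hM : M ∈ Set.Icc
    (ρ.1 + ρ.2 0 + ρ.2 1 - 2 / K * min (ρ.2 0) (ρ.2 1)) (ρ.1 + ρ.2 0 + ρ.2 1)) :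
    ∃ t ∈ Set.Icc (0 : ℝ) 1, HasLoad (memoryShare t (allButOneCaching K) (fullCaching K)) ρ.2
      (M - ρ.1) (fun _ => (ρ.1 + ρ.2 0 + ρ.2 1 - M) / 2) := by
  obtain ⟨t, ht, htM⟩ := exists_fraction (a := ρ.1 + ρ.2 0 + ρ.2 1 - M)
    (b := 2 / K * min (ρ.2 0) (ρ.2 1)) (by linarith [hM.2]) (by linarith [hM.1])
  refine ⟨t, ht, ?_⟩
  have hL := (hasLoad_allButOneCaching (K := K) (by omega) (fun i => t * ρ.2 i)).memoryShare ht
    (hasLoad_fullCaching (fun i => (1 - t) * ρ.2 i))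
  convert hL using 1
  · rw [← mul_min_of_nonneg _ _ ht.1]
    linear_combination htM
  · funext d
    rw [← mul_min_of_nonneg _ _ ht.1]
    linear_combination -htM / 2

theorem proposedPeak_large (hK : 2 ≤ K) {M : ℝ} (hM : M ∈ Set.Icc
    (ρ.1 + ρ.2 0 + ρ.2 1 - 2 / K * min (ρ.2 0) (ρ.2 1)) (ρ.1 + ρ.2 0 + ρ.2 1)) :
    ((ρ.1 + ρ.2 0 + ρ.2 1 - M) / 2, M) ∈ closure (proposedPeakAchievable K ρ) := by
  obtain ⟨t, ht, hL⟩ := hasLoad_large hK hM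
  exact mem_closure_proposedPeak hρ (μ₀ := ρ.1) ⟨h₀, le_rfl⟩ (MemorySharing.share t _ _ ht
    (MemorySharing.base _ (by simp)) (MemorySharing.base _ (by simp))) hL (by linarith)
    fun d => by linarith

theorem proposedAvg_large (hK : 2 ≤ K) {M : ℝ} (hM : M ∈ Set.Icc
    (ρ.1 + ρ.2 0 + ρ.2 1 - 2 / K * min (ρ.2 0) (ρ.2 1)) (ρ.1 + ρ.2 0 + ρ.2 1)) :
    ((ρ.1 + ρ.2 0 + ρ.2 1 - M) / 2, M) ∈ closure (proposedAvgAchievable K ρ) := by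
  obtain ⟨t, ht, hL⟩ := hasLoad_large hK hM
  refine mem_closure_proposedAvg hρ (μ₀ := ρ.1) ⟨h₀, le_rfl⟩ (MemorySharing.share t _ _ ht
    (MemorySharing.base _ (by simp)) (MemorySharing.base _ (by simp))) hL (by linarith) ?_
  simp only [Finset.sum_const, Finset.card_univ, Fintype.card_fun, Fintype.card_fin,
    nsmul_eq_mul, Nat.cast_pow, Nat.cast_ofNat]
  rw [mul_div_cancel_left₀ _ (by positivity)]
  linarith

theorem proposedPeak_two_middle {M : ℝ} (hM : M ∈ Set.Icc (min (ρ.2 0) (ρ.2 1) / 2)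
    (ρ.1 + ρ.2 0 + ρ.2 1 - min (ρ.2 0) (ρ.2 1))) :
    (ρ.1 + ρ.2 0 + ρ.2 1 - min (ρ.2 0) (ρ.2 1) / 2 - M, M) ∈
      closure (proposedPeakAchievable 2 ρ) := by
  set m := min (ρ.2 0) (ρ.2 1) with hm
  have hm0 : m ≤ ρ.2 0 := min_le_left _ _
  have hm1 : m ≤ ρ.2 1 := min_le_right _ _
  have hmn : 0 ≤ m := le_min (hρ 0) (hρ 1)
  -- Memory beyond the coded-placement point `m / 2` goes first to `W₀`, then to moving the private
  -- part from coded to all-but-one caching. Both have slope `-1`: for `K = 2` the latter move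
  -- raises the memory and lowers the load bound by the same `ρ.2 0 + ρ.2 1 - 3 m / 2`.
  set μ₀ := min ρ.1 (M - m / 2)
  have hμ : μ₀ ∈ Set.Icc 0 ρ.1 := ⟨le_min h₀ (by linarith [hM.1]), min_le_left _ _⟩
  obtain ⟨t, ht, htM⟩ := exists_fraction (a := ρ.2 0 + ρ.2 1 - 3 / 2 * m - (M - m / 2 - μ₀))
    (b := ρ.2 0 + ρ.2 1 - 3 / 2 * m) (by
      rcases min_choice ρ.1 (M - m / 2) with h | h
      · have : μ₀ = ρ.1 := h
        linarith [hM.2]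
      · have : μ₀ = M - m / 2 := h
        linarith) (by
      have : μ₀ ≤ M - m / 2 := min_le_right _ _
      linarith)
  have h1 : 0 ≤ 1 - t := by linarith [ht.2]
  have hL := (hasLoad_codedCaching (K := 2) (by omega) (fun i => t * ρ.2 i)).memoryShare ht
    (hasLoad_allButOneCaching (by omega) (fun i => (1 - t) * ρ.2 i))
  refine mem_closure_proposedPeak hρ hμ (MemorySharing.share t _ _ ht
    (MemorySharing.base _ (by simp)) (MemorySharing.base _ (by simp))) hL ?_ fun d => ?_
  · rw [← mul_min_of_nonneg _ _ ht.1, ← mul_min_of_nonneg _ _ h1, ← hm]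
    push_cast
    refine le_of_eq ?_
    linear_combination -htM
  · have e1 := codedCaching_load_le (K := 2) le_rfl d (r := fun i => t * ρ.2 i)
      fun i => mul_nonneg ht.1 (hρ i)
    rw [← mul_min_of_nonneg _ _ h1]
    simp only [← mul_min_of_nonneg _ _ ht.1, ← hm] at e1 ⊢
    push_cast at e1 ⊢
    linarith

omit h₀ hρ in
-- Each file is requested in three of the four demands.
theorem sum_requestedRate_two (r : Fin 2 → ℝ) :
    ∑ d : Demand 2, requestedRate d r = 3 * (r 0 + r 1) := by
  rw [sum_demand_two]
  simp [requestedRate, Requested, Fin.exists_fin_two]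
  ring

omit h₀ hρ in
theorem leaderPairs_length_two (d : Demand 2) : (leaderPairs d).length = 1 := by
  revert d; decide

theorem proposedAvg_two_small {M : ℝ} (hM : M ∈ Set.Icc 0 (ρ.1 + min (ρ.2 0) (ρ.2 1))) :
    (ρ.1 + 3 / 4 * (ρ.2 0 + ρ.2 1) - M, M) ∈ closure (proposedAvgAchievable 2 ρ) := by
  set m := min (ρ.2 0) (ρ.2 1) with hm
  have hmn : 0 ≤ m := le_min (hρ 0) (hρ 1)
  -- Memory goes to `W₀` first and then to uncoded placement. The second phase has slope `-1` as
  -- well: for `K = 2`, `m` cached bits lower the average load from `3/4 (ρ.2 0 + ρ.2 1)` by `3/2 m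
  -- - m/2`.
  set μ₀ := min ρ.1 M
  have hμ : μ₀ ∈ Set.Icc 0 ρ.1 := ⟨le_min h₀ hM.1, min_le_left _ _⟩
  obtain ⟨t, ht, htM⟩ := exists_fraction (a := M - μ₀) (b := m)
    (sub_nonneg.2 (min_le_right _ _)) (by
      rcases min_choice ρ.1 M with h | h
      · have : μ₀ = ρ.1 := h
        linarith [hM.2]
      · have : μ₀ = M := h
        linarith)
  have hL := (hasLoad_uncodedCaching (K := 2) (by omega) (fun i => t * ρ.2 i)).memoryShare ht
    (hasLoad_noCaching (fun i => (1 - t) * ρ.2 i))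
  refine mem_closure_proposedAvg hρ hμ (MemorySharing.share t _ _ ht
    (MemorySharing.base _ (by simp)) (MemorySharing.base _ (by simp))) hL ?_ ?_
  · rw [← mul_min_of_nonneg _ _ ht.1, ← hm]
    push_cast
    linarith
  · simp only [Finset.sum_add_distrib, sum_requestedRate_two, leaderPairs_length_two,
      ← mul_min_of_nonneg _ _ ht.1, ← hm, Finset.sum_const, Finset.card_univ, Fintype.card_fun,
      Fintype.card_fin, nsmul_eq_mul]
    push_cast
    refine le_of_eq ?_
    linear_combination -htM

theorem proposedAvg_two_middle {M : ℝ} (hM : M ∈ Set.Icc (ρ.1 + min (ρ.2 0) (ρ.2 1))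
    (ρ.1 + ρ.2 0 + ρ.2 1 - min (ρ.2 0) (ρ.2 1))) :
    (min (ρ.2 0) (ρ.2 1) / 2 + 3 / 4 * (ρ.1 + ρ.2 0 + ρ.2 1 - min (ρ.2 0) (ρ.2 1) - M), M) ∈
      closure (proposedAvgAchievable 2 ρ) := by
  set m := min (ρ.2 0) (ρ.2 1) with hm
  -- Moving from uncoded placement to all-but-one caching stores the leftovers, of total rate `ρ.2 0
  -- + ρ.2 1 - 2 m`; each is requested with probability `3/4`, hence the slope.
  obtain ⟨t, ht, htM⟩ := exists_fraction (a := ρ.1 + ρ.2 0 + ρ.2 1 - m - M)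
    (b := ρ.2 0 + ρ.2 1 - 2 * m) (by linarith [hM.2]) (by linarith [hM.1])
  have h1 : 0 ≤ 1 - t := by linarith [ht.2]
  have hL := (hasLoad_uncodedCaching (K := 2) (by omega) (fun i => t * ρ.2 i)).memoryShare ht
    (hasLoad_allButOneCaching (by omega) (fun i => (1 - t) * ρ.2 i))
  refine mem_closure_proposedAvg hρ (μ₀ := ρ.1) ⟨h₀, le_rfl⟩ (MemorySharing.share t _ _ ht
    (MemorySharing.base _ (by simp)) (MemorySharing.base _ (by simp))) hL ?_ ?_
  · rw [← mul_min_of_nonneg _ _ ht.1, ← mul_min_of_nonneg _ _ h1, ← hm]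
    push_cast
    refine le_of_eq ?_
    linear_combination -htM
  · simp only [Finset.sum_add_distrib, sum_requestedRate_two, leaderPairs_length_two,
      ← mul_min_of_nonneg _ _ ht.1, ← mul_min_of_nonneg _ _ h1, ← hm, Finset.sum_const,
      Finset.card_univ, Fintype.card_fun, Fintype.card_fin, nsmul_eq_mul]
    push_cast
    refine le_of_eq ?_
    linear_combination 3 / 4 * htM

end Points

/-! ### Entropies of the overlapping source -/

section Source

variable {S T U W : Type*} [Fintype S]

theorem law_mem_stdSimplex [Fintype T] [DecidableEq T] {q : S → ℝ} (hq : q ∈ stdSimplex ℝ S)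
    (φ : S → T) : law q φ ∈ stdSimplex ℝ T := by
  refine ⟨fun t => Finset.sum_nonneg fun s _ => hq.1 s, ?_⟩
  simp only [law_eq_pmass]
  rw [sum_pmass φ (fun s => Finset.mem_univ _), hq.2]

theorem ent_law [Fintype T] [DecidableEq T] (q : S → ℝ) (φ : S → T) (f : T → U) :
    ent (law q φ) f = ent q (fun s => f (φ s)) := by
  classical
  have hm : ∀ u, pmass (law q φ) f u = pmass q (fun s => f (φ s)) u := by
    intro u
    have := sum_fiber q φ ({t | f t = u}.indicator fun _ => (1 : ℝ)) (A := Finset.univ) (by simp)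
    simp only [Set.indicator_apply, Set.mem_ofPred_eq, mul_ite, mul_one, mul_zero] at this
    simp only [pmass, Set.indicator_apply, Set.mem_ofPred_eq, law_eq_pmass] at this ⊢
    exact this.symm
  have := sum_fiber q φ (fun t => Real.logb 2 (pmass q (fun s => f (φ s)) (f t)))
    (A := Finset.univ) (by simp)
  simp only [ent, hm, this, law_eq_pmass]

/-- Conditional independence is the equality case of submodularity; it holds already for the
surprisals at each point of positive mass. -/
theorem CondIndep.ent_add [DecidableEq T] [DecidableEq U] [DecidableEq W] {q : S → ℝ}
    (hq : ∀ s, 0 ≤ q s) {f : S → T} {g : S → U} {h : S → W} (hci : CondIndep q f g h) :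
    ent q (fun s => (f s, g s, h s)) + ent q h =
      ent q (fun s => (f s, h s)) + ent q (fun s => (g s, h s)) := by
  unfold ent
  rw [← neg_add, ← neg_add, ← Finset.sum_add_distrib, ← Finset.sum_add_distrib]
  congr 1
  refine Finset.sum_congr rfl fun s _ => ?_
  rcases (hq s).eq_or_lt with h' | h'
  · simp [← h']
  · have e := hci (f s) (g s) (h s)
    simp only [law_eq_pmass] at e
    rw [← mul_add, ← mul_add,
      ← Real.logb_mul (pmass_pos hq (fun s => (f s, g s, h s)) h').ne' (pmass_pos hq h h').ne',
      ← Real.logb_mul (pmass_pos hq (fun s => (f s, h s)) h').ne'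
        (pmass_pos hq (fun s => (g s, h s)) h').ne', e]

end Source

/-- An achievable point that meets the converse determines both optimal rates. -/
theorem sInf_rateMemoryFunction_eq {P : Type*} {G : Set P} {ℬ : P → Set (ℝ × ℝ)}
    {𝒜 : Set (ℝ × ℝ)} {M f : ℝ} (hsub : ∀ ρ ∈ G, closure (ℬ ρ) ⊆ closure 𝒜)
    (hne : ∀ ρ ∈ G, ∃ R, (R, M) ∈ closure (ℬ ρ)) (hlow : ∀ z ∈ closure 𝒜, z.2 = M → f ≤ z.1)
    {ρ₀ : P} (hρ₀ : ρ₀ ∈ G) (hmem : (f, M) ∈ closure (ℬ ρ₀)) :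
    sInf ((fun ρ => rateMemoryFunction (ℬ ρ) M) '' G) = rateMemoryFunction 𝒜 M := by
  have hl : ∀ ρ ∈ G, f ≤ rateMemoryFunction (ℬ ρ) M := fun ρ hρ =>
    le_csInf (hne ρ hρ) fun R hR => hlow _ (hsub ρ hρ hR) rfl
  have hb : BddBelow {R | (R, M) ∈ closure 𝒜} := ⟨f, fun R hR => hlow _ hR rfl⟩
  have h1 : rateMemoryFunction 𝒜 M = f := le_antisymm (csInf_le hb (hsub ρ₀ hρ₀ hmem))
    (le_csInf ⟨f, hsub ρ₀ hρ₀ hmem⟩ fun R hR => hlow _ hR rfl)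
  have h2 : rateMemoryFunction (ℬ ρ₀) M ≤ f :=
    csInf_le (hb.mono fun R hR => hsub ρ₀ hρ₀ hR) hmem
  have h3 : f ∈ lowerBounds ((fun ρ => rateMemoryFunction (ℬ ρ) M) '' G) := by
    rintro _ ⟨ρ, hρ, rfl⟩
    exact hl ρ hρ
  rw [h1]
  exact le_antisymm ((csInf_le ⟨f, h3⟩ ⟨ρ₀, hρ₀, rfl⟩).trans h2) (le_csInf ⟨_, ρ₀, hρ₀, rfl⟩ h3)

end GWCaching

/-! ### Matching the achieved points with the converse -/

open GWCaching
theorem mainTheorem12 {A : Fin 2 → Type*} {B : Type*}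
    [∀ i, Fintype (A i)] [∀ i, DecidableEq (A i)] [Fintype B] [DecidableEq B]
    (q : (∀ i, A i) × B → ℝ) (hq : q ∈ stdSimplex ℝ ((∀ i, A i) × B))
    (hci : CondIndep q (fun s => s.1 0) (fun s => s.1 1) (fun s => s.2))
    (p : (∀ i, A i × B) → ℝ) (hp : p = overlapSource q)
    (H Γ : ℝ) (hH : H = entropy p (fun x => x))
    (hΓ : Γ = min (condEntropy p (fun x => x 0) (fun x => x 1))
      (condEntropy p (fun x => x 1) (fun x => x 0)))
    (K : ℕ) (hK : 2 ≤ K) :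
    (∀ M ∈ Set.Icc 0 (Γ / K) ∪ Set.Icc (H - 2 / K * Γ) H, gwmrPeak p K M = optimalPeak p K M) ∧
    (∀ M ∈ Set.Icc (H - 2 / K * Γ) H, gwmrAvg p K M = optimalAvg p K M) ∧
    (K = 2 → ∀ M ∈ Set.Icc 0 H,
      gwmrPeak p K M = optimalPeak p K M ∧ gwmrAvg p K M = optimalAvg p K M) := by
  have hp1 : p ∈ stdSimplex ℝ (∀ i, A i × B) := by
    rw [hp]; exact law_mem_stdSimplex hq _
  have hκ : ∀ y, p y ≠ 0 → (y 0).2 = (y 1).2 := by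
    intro y hy
    rw [hp, overlapSource, law] at hy
    obtain ⟨s, hs, -⟩ := Finset.exists_ne_zero_of_sum_ne_zero hy
    rw [← (Finset.mem_filter.1 hs).2]
  have hmem := mem_gwRegion_of_common hp1 (fun i y => y.2) hκ
  rw [entropy_eq_ent] at hH
  rw [condEntropy_eq_ent hp1, condEntropy_eq_ent hp1,
    ent_congr (f := fun x : ∀ i, A i × B => (x 0, x 1)) (g := fun x => x) (by
      simp [funext_iff, Fin.forall_fin_two]),
    ent_congr (f := fun x : ∀ i, A i × B => (x 1, x 0)) (g := fun x => x) (by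
      simp [funext_iff, Fin.forall_fin_two, and_comm]), ← hH] at hΓ
  have hV : ent p (fun y => (y 1).2) = ent p (fun y => (y 0).2) :=
    (ent_congr_ae hκ).symm
  -- Both files contain `V`, so conditional independence of their other components reads `H(X₁,X₂) +
  -- H(V) = H(X₁) + H(X₂)`. This identifies the private rates with the conditional entropies in `Γ`.
  have hsum : H + ent p (fun y => (y 0).2) = ent p (fun y => y 0) + ent p (fun y => y 1) := by
    have h1 := hci.ent_add hq.1
    rw [hH, hp, overlapSource, ent_law, ent_law, ent_law, ent_law, ← h1]
    congr 1
    refine ent_congr fun s s' => ?_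
    simp only [funext_iff, Fin.forall_fin_two, Prod.mk.injEq]
    tauto
  set ρ : ℝ × (Fin 2 → ℝ) := (ent p (fun y => (y 0).2),
    fun i => ent p (fun y => y i) - ent p (fun y => (y i).2)) with hρ
  obtain ⟨hρ0, hρi⟩ := nonneg_of_mem_gwRegion hp1 hmem
  have hr0 : ρ.2 0 = H - ent p (fun y => y 1) := by
    simp only [hρ]; linarith
  have hr1 : ρ.2 1 = H - ent p (fun y => y 0) := by
    simp only [hρ]; linarith
  have hHρ : H = ρ.1 + ρ.2 0 + ρ.2 1 := by
    rw [hr0, hr1]; simp only [hρ]; linarith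
  rw [← hr0, ← hr1] at hΓ
  have hid : ent p id = H := hH.symm
  have hΓ0 : 0 ≤ Γ := hΓ ▸ le_min (hρi 0) (hρi 1)
  have hΓr0 : Γ ≤ ρ.2 0 := hΓ ▸ min_le_left _ _
  have hΓr1 : Γ ≤ ρ.2 1 := hΓ ▸ min_le_right _ _
  -- Ensures that the large-memory interval consists of nonnegative `M`.
  have hKΓ : 2 / K * Γ ≤ Γ := mul_le_of_le_one_left hΓ0
    ((div_le_one (by positivity)).2 (by exact_mod_cast hK))
  have peak : ∀ M f, 0 ≤ M → (∀ z ∈ closure (peakAchievable p K), z.2 = M → f ≤ z.1) →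
      (f, M) ∈ closure (proposedPeakAchievable K ρ) → gwmrPeak p K M = optimalPeak p K M :=
    fun M f hM hlow hf => sInf_rateMemoryFunction_eq
      (fun ρ hρ => closure_proposedPeak_subset hp1 hρ)
      (fun ρ hρ => ⟨_, proposedPeak_nonempty (nonneg_of_mem_gwRegion hp1 hρ).1
        (nonneg_of_mem_gwRegion hp1 hρ).2 hM⟩) hlow hmem hf
  have avg : ∀ M f, 0 ≤ M → (∀ z ∈ closure (avgAchievable p K), z.2 = M → f ≤ z.1) →
      (f, M) ∈ closure (proposedAvgAchievable K ρ) → gwmrAvg p K M = optimalAvg p K M :=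
    fun M f hM hlow hf => sInf_rateMemoryFunction_eq
      (fun ρ hρ => closure_proposedAvg_subset hp1 hρ)
      (fun ρ hρ => ⟨_, proposedAvg_nonempty (nonneg_of_mem_gwRegion hp1 hρ).1
        (nonneg_of_mem_gwRegion hp1 hρ).2 hM⟩) hlow hmem hf
  have peak_small : ∀ M ∈ Set.Icc 0 (Γ / K), gwmrPeak p K M = optimalPeak p K M := fun M hM =>
    peak M _ hM.1 (fun z hz hzM => by
      have := peak_two_caches hp1 hK z hz
      rw [hid, hzM] at this
      linarith) (proposedPeak_small hρ0 hρi hK (hΓ ▸ hM))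
  have peak_large : ∀ M ∈ Set.Icc (H - 2 / K * Γ) H, gwmrPeak p K M = optimalPeak p K M :=
    fun M hM => peak M _ (by linarith [hM.1]) (fun z hz hzM => by
      have := peak_two_codewords hp1 hK z hz
      rw [hid, hzM] at this
      linarith) (proposedPeak_large hρ0 hρi hK (by rw [← hHρ, ← hΓ]; exact hM))
  have avg_large : ∀ M ∈ Set.Icc (H - 2 / K * Γ) H, gwmrAvg p K M = optimalAvg p K M :=
    fun M hM => avg M _ (by linarith [hM.1]) (fun z hz hzM => by
      have := avg_two_codewords hp1 hK z hz
      rw [hid, hzM] at this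
      linarith) (proposedAvg_large hρ0 hρi hK (by rw [← hHρ, ← hΓ]; exact hM))
  refine ⟨fun M hM => hM.elim (peak_small M) (peak_large M), avg_large, ?_⟩
  rintro rfl M hM
  simp only [Nat.cast_ofNat, div_self (two_ne_zero (α := ℝ)), one_mul]
    at peak_small peak_large avg_large
  -- If one private rate equals `Γ`, the other file has entropy `H - Γ`; this is the file to insert
  -- in the submodularity bounds.
  have hmid : ∃ i, ent p (fun y => y i) = H - Γ := by
    rcases min_choice (ρ.2 0) (ρ.2 1) with h | h
    · exact ⟨1, by linarith⟩
    · exact ⟨0, by linarith⟩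
  obtain ⟨i, hi⟩ := hmid
  constructor
  · rcases le_total M (Γ / 2) with h1 | h1
    · exact peak_small M ⟨hM.1, h1⟩
    rcases le_total (H - Γ) M with h2 | h2
    · exact peak_large M ⟨h2, hM.2⟩
    refine peak M _ hM.1 (fun z hz hzM => ?_) (proposedPeak_two_middle hρ0 hρi
      (by rw [← hHρ, ← hΓ]; exact ⟨h1, h2⟩))
    have := peak_two_each hp1 hK i z hz
    rw [hid, hzM, hi] at this
    linarith
  · rcases le_total (H - Γ) M with h2 | h2
    · exact avg_large M ⟨h2, hM.2⟩
    rcases le_total M (ρ.1 + Γ) with h1 | h1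
    · refine avg M _ hM.1 (fun z hz hzM => ?_) (proposedAvg_two_small hρ0 hρi
        (by rw [← hΓ]; exact ⟨hM.1, h1⟩))
      have := avg_four_caches hp1 z hz
      rw [hid, hzM] at this
      linarith
    · refine avg M _ hM.1 (fun z hz hzM => ?_) (proposedAvg_two_middle hρ0 hρi
        (by rw [← hHρ, ← hΓ]; exact ⟨h1, h2⟩))
      have := avg_three_caches hp1 i z hz
      rw [hid, hzM, hi] at this
      linarith
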